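/- Let $d\ge 1$ and let $\phi_0$ be a probability density on $\mathbb R^d$ (that is, $\phi_0\ge 0$, $\phi_0\in L^1(\mathbb R^d)$, $\int\phi_0\,dx=1$). For $t>0$ let $\phi_t=\phi_0*p_t$, where $p_t(x)=(4\pi t)^{-d/2}e^{-|x|^2/(4t)}$ is the heat kernel. For a probability density $\rho$ put $$S_q(\rho)=\frac{1-\int_{\mathbb R^d}\rho^q\,dx}{q-1}\quad(q>1),\qquad S_1(\rho)=-\int_{\mathbb R^d}\rho\log\rho\,dx .$$ Let $q\in[1,3]$ if $d=1$, and $q\in\big[1,\tfrac{2(\sqrt5+1)}{\sqrt5}\big]$ (where $\tfrac{2(\sqrt5+1)}{\sqrt5}\approx 2.894$) if $d>1$. Then $S_q(\phi_t)$ is finite for every $t>0$, the function $t\mapsto S_q(\phi_t)$ is concave and twice differentiable on $(0,\infty)$, and $$\frac{d^2}{dt^2}S_q(\phi_t)\le 0\qquad\text{for all } t>0,$$ with the only exception that for $q=1$ it may happen that $S_1(\phi_t)=+\infty$ for every $t>0$. -/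

import Mathlib

open MeasureTheory Set

noncomputable section

/-- `ρ` is a probability density on `ℝ^d` with respect to Lebesgue measure. -/
structure IsProbDensity {d : ℕ} (ρ : EuclideanSpace ℝ (Fin d) → ℝ) : Prop where
  nonneg : ∀ᵐ x, 0 ≤ ρ x
  integrable : Integrable ρ
  integral_eq_one : ∫ x, ρ x = 1

/-- The Gaussian heat kernel `p_t(x) = (4πt)^(-d/2) exp(-|x|²/(4t))` on `ℝ^d`, used for `t > 0`. -/
def heatKernel (d : ℕ) (t : ℝ) (x : EuclideanSpace ℝ (Fin d)) : ℝ :=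
  (4 * Real.pi * t) ^ (-(d : ℝ) / 2) * Real.exp (-‖x‖ ^ 2 / (4 * t))

/-- The heat flow `φ_t = φ₀ * p_t`, used for `t > 0`. -/
def heatFlow {d : ℕ} (φ₀ : EuclideanSpace ℝ (Fin d) → ℝ) (t : ℝ) :
    EuclideanSpace ℝ (Fin d) → ℝ :=
  convolution φ₀ (heatKernel d t) (ContinuousLinearMap.mul ℝ ℝ) volume

/-- The Tsallis entropy `S_q(ρ) = (1 - ∫ ρ^q) / (q - 1)` for `q ≠ 1`; for `q = 1` it is the
Shannon entropy `-∫ ρ log ρ`. The value is meaningful when `TsallisFinite q ρ` holds. -/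
def tsallisEntropy {d : ℕ} (q : ℝ) (ρ : EuclideanSpace ℝ (Fin d) → ℝ) : ℝ :=
  if q = 1 then -∫ x, ρ x * Real.log (ρ x) else (1 - ∫ x, ρ x ^ q) / (q - 1)

/-- The integral that defines `S_q(ρ)` converges absolutely, i.e. `S_q(ρ)` is finite. -/
def TsallisFinite {d : ℕ} (q : ℝ) (ρ : EuclideanSpace ℝ (Fin d) → ℝ) : Prop :=
  if q = 1 then Integrable (fun x => ρ x * Real.log (ρ x)) else Integrable (fun x => ρ x ^ q)

/-- The Shannon entropy `-∫ ρ log ρ` is well defined in `[-∞, ∞]` and equals `+∞`: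
the positive part of `-ρ log ρ` has infinite integral, the negative part a finite one. -/
def ShannonEntropyEqTop {d : ℕ} (ρ : EuclideanSpace ℝ (Fin d) → ℝ) : Prop :=
  ∫⁻ x, ENNReal.ofReal (-(ρ x * Real.log (ρ x))) = ⊤ ∧
    ∫⁻ x, ENNReal.ofReal (ρ x * Real.log (ρ x)) < ⊤

end

open Filter Topology

noncomputable section

/-! Write u for the heat flow and I_q = ∫ u^(q-2) |∇u|² (`fisherInfo`). The heat equation and one
integration by parts give d/dt ∫ u^q = -q(q-1) I_q, so S_q' = q I_q, and everything reduces to I_q'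
≤ 0.

Differentiating I_q produces the term 2 u^(q-2) ∇u·∇Δu. It can be integrated by parts either into
(Δu)² or into |∇²u|²; the weights l and β with l + β = 2 split it between the two, and γ adds a
multiple of the null integral of div(u^(q-3) |∇u|² ∇u). The result is I_q' = -∫ u^(q-2) Q with Q a
quadratic form in Δu, ∇²u and ∇u/√u (`integral_fisherRate`). Suitable l, β, γ make Q a sum of
squares exactly in the ranges treated by `exists_dissipationForm_nonneg`.

The analysis rests on `exists_envelope`. Kernel derivatives are at most a polynomial times the
kernel, hence at most c·W with W an average of exp(ε|z|²) p_t, and Jensen's inequality gives W⁴ ≤ u³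
· (an integrable Gaussian average). So every product of homogeneous degree q in u and its
derivatives, with at most four factors other than the power of u, is dominated locally uniformly in
time. This justifies all differentiations under the integral, and integration by parts without decay
estimates.

For q = 1 the logarithm is approximated by (x^h - 1)/h. The identity S' = (1+h) I_(1+h) is
integrated in time and h is sent to 0: Fatou's lemma shows that finiteness at one time implies
finiteness at all times (`integrable_mul_log_of_integrable`), and dominated convergence gives S_1' =
I_1. -/

/-- The Kronecker symbol with real values. -/
def kroneckerDelta {d : ℕ} (i j : Fin d) : ℝ := if i = j then 1 else 0

lemma kroneckerDelta_comm {d : ℕ} (i j : Fin d) : kroneckerDelta i j = kroneckerDelta j i := by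
  simp [kroneckerDelta, eq_comm]

lemma sum_kroneckerDelta_mul {d : ℕ} (i : Fin d) (f : Fin d → ℝ) :
    ∑ j, kroneckerDelta i j * f j = f i := by
  simp [kroneckerDelta]

lemma abs_kroneckerDelta_le {d : ℕ} (i j : Fin d) : |kroneckerDelta i j| ≤ 1 := by
  unfold kroneckerDelta; split_ifs <;> simp

/-! ### The heat kernel: derivatives in space and time -/

/-- First partial derivatives of the heat kernel. -/
def gradKernel (d : ℕ) (i : Fin d) (t : ℝ) (z : EuclideanSpace ℝ (Fin d)) : ℝ :=
  -(z i) / (2 * t) * heatKernel d t z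

/-- Second partial derivatives of the heat kernel. -/
def hessKernel (d : ℕ) (i j : Fin d) (t : ℝ) (z : EuclideanSpace ℝ (Fin d)) : ℝ :=
  (z i * z j / (4 * t ^ 2) - kroneckerDelta i j / (2 * t)) * heatKernel d t z

/-- Third partial derivatives of the heat kernel. -/
def thirdKernel (d : ℕ) (i j k : Fin d) (t : ℝ) (z : EuclideanSpace ℝ (Fin d)) : ℝ :=
  (-(z i * z j * z k) / (8 * t ^ 3) + (kroneckerDelta i j * z k + kroneckerDelta i k * z j
    + kroneckerDelta j k * z i) / (4 * t ^ 2)) * heatKernel d t z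

section Derivatives

variable {d : ℕ}

lemma hasDerivAt_line_apply (i j : Fin d) (z : EuclideanSpace ℝ (Fin d)) (s : ℝ) :
    HasDerivAt (fun s : ℝ => (z + s • EuclideanSpace.single i (1 : ℝ)) j) (kroneckerDelta i j) s := by
  have h : (fun s : ℝ => (z + s • EuclideanSpace.single i (1 : ℝ)) j)
      = fun s => z j + s * kroneckerDelta i j := by
    funext s
    simp [kroneckerDelta, eq_comm]
  rw [h]
  simpa using ((hasDerivAt_id s).mul_const (kroneckerDelta i j)).const_add (z j)

lemma hasDerivAt_line_heatKernel (i : Fin d) {t : ℝ} (ht : 0 < t)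
    (z : EuclideanSpace ℝ (Fin d)) (s : ℝ) :
    HasDerivAt (fun s : ℝ => heatKernel d t (z + s • EuclideanSpace.single i (1 : ℝ)))
      (gradKernel d i t (z + s • EuclideanSpace.single i (1 : ℝ))) s := by
  have h1 : HasDerivAt (fun s : ℝ => z + s • EuclideanSpace.single i (1 : ℝ))
      (EuclideanSpace.single i (1 : ℝ)) s := by
    simpa using ((hasDerivAt_id s).smul_const (EuclideanSpace.single i (1 : ℝ))).const_add z
  have h2 := (((h1.norm_sq).neg.div_const (4 * t)).exp).const_mul
    ((4 * Real.pi * t) ^ (-(d : ℝ) / 2))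
  refine h2.congr_deriv ?_
  simp only [EuclideanSpace.inner_single_right, gradKernel, heatKernel]
  simp only [Pi.neg_apply]
  simp
  field_simp
  ring

lemma hasDerivAt_line_gradKernel (i l : Fin d) {t : ℝ} (ht : 0 < t)
    (z : EuclideanSpace ℝ (Fin d)) (s : ℝ) :
    HasDerivAt (fun s : ℝ => gradKernel d i t (z + s • EuclideanSpace.single l (1 : ℝ)))
      (hessKernel d i l t (z + s • EuclideanSpace.single l (1 : ℝ))) s := by
  refine (((hasDerivAt_line_apply l i z s).neg.div_const (2 * t)).mul
    (hasDerivAt_line_heatKernel l ht z s)).congr_deriv ?_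
  simp only [gradKernel, hessKernel, Pi.neg_apply, kroneckerDelta_comm l i]
  field_simp
  ring

lemma hasDerivAt_line_hessKernel (i j l : Fin d) {t : ℝ} (ht : 0 < t)
    (z : EuclideanSpace ℝ (Fin d)) (s : ℝ) :
    HasDerivAt (fun s : ℝ => hessKernel d i j t (z + s • EuclideanSpace.single l (1 : ℝ)))
      (thirdKernel d i j l t (z + s • EuclideanSpace.single l (1 : ℝ))) s := by
  refine (((((hasDerivAt_line_apply l i z s).mul (hasDerivAt_line_apply l j z s)).div_const
    (4 * t ^ 2)).sub_const (kroneckerDelta i j / (2 * t))).mul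
    (hasDerivAt_line_heatKernel l ht z s)).congr_deriv ?_
  simp only [gradKernel, thirdKernel, Pi.mul_apply, kroneckerDelta_comm l]
  field_simp
  ring

/-- The heat equation for the kernel, with the Laplacian written as the trace of the Hessian. -/
lemma hasDerivAt_time_heatKernel (z : EuclideanSpace ℝ (Fin d)) {t : ℝ} (ht : 0 < t) :
    HasDerivAt (fun t => heatKernel d t z) (∑ j, hessKernel d j j t z) t := by
  have h0 : HasDerivAt (fun t : ℝ => 4 * Real.pi * t) (4 * Real.pi) t := by
    simpa using (hasDerivAt_id t).const_mul (4 * Real.pi)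
  have hpos : 0 < 4 * Real.pi * t := by positivity
  have h1 := h0.rpow_const (p := -(d : ℝ) / 2) (Or.inl hpos.ne')
  have h2 : HasDerivAt (fun t : ℝ => -‖z‖ ^ 2 / (4 * t)) (‖z‖ ^ 2 / (4 * t ^ 2)) t := by
    have h3 : HasDerivAt (fun t : ℝ => 4 * t) 4 t := by
      simpa using (hasDerivAt_id t).const_mul 4
    refine ((hasDerivAt_const t (-‖z‖ ^ 2)).div h3 (by positivity)).congr_deriv ?_
    field_simp
    ring
  refine (h1.mul h2.exp).congr_deriv ?_
  have hs : ∑ j, hessKernel d j j t z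
      = (‖z‖ ^ 2 / (4 * t ^ 2) - d / (2 * t)) * heatKernel d t z := by
    simp only [hessKernel]
    rw [← Finset.sum_mul, Finset.sum_sub_distrib, EuclideanSpace.real_norm_sq_eq, Finset.sum_div]
    simp [kroneckerDelta, pow_two]
    left
    ring
  rw [hs, heatKernel, Real.rpow_sub_one hpos.ne']
  field_simp
  ring

lemma hasDerivAt_time_gradKernel (i : Fin d) (z : EuclideanSpace ℝ (Fin d)) {t : ℝ} (ht : 0 < t) :
    HasDerivAt (fun t => gradKernel d i t z) (∑ j, thirdKernel d i j j t z) t := by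
  have h1 : HasDerivAt (fun t : ℝ => -(z i) / (2 * t)) (z i / (2 * t ^ 2)) t := by
    have h3 : HasDerivAt (fun t : ℝ => 2 * t) 2 t := by
      simpa using (hasDerivAt_id t).const_mul 2
    refine ((hasDerivAt_const t (-(z i))).div h3 (by positivity)).congr_deriv ?_
    field_simp
    ring
  refine (h1.mul (hasDerivAt_time_heatKernel z ht)).congr_deriv ?_
  have h2 : ∀ j, thirdKernel d i j j t z = -(z i) / (2 * t) * hessKernel d j j t z
      + kroneckerDelta i j * (z j * (heatKernel d t z / (2 * t ^ 2))) := by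
    intro j
    simp only [thirdKernel, hessKernel]
    field_simp
    ring
  simp only [h2, Finset.sum_add_distrib, sum_kroneckerDelta_mul, ← Finset.mul_sum]
  ring

lemma hessKernel_comm (i j : Fin d) (t : ℝ) (z : EuclideanSpace ℝ (Fin d)) :
    hessKernel d i j t z = hessKernel d j i t z := by
  simp only [hessKernel, kroneckerDelta_comm i j, mul_comm (z i)]

lemma thirdKernel_comm_left (i j k : Fin d) (t : ℝ) (z : EuclideanSpace ℝ (Fin d)) :
    thirdKernel d i j k t z = thirdKernel d j i k t z := by
  simp only [thirdKernel, kroneckerDelta_comm i j]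
  ring

lemma thirdKernel_comm_right (i j k : Fin d) (t : ℝ) (z : EuclideanSpace ℝ (Fin d)) :
    thirdKernel d i j k t z = thirdKernel d i k j t z := by
  simp only [thirdKernel, kroneckerDelta_comm j k]
  ring

@[fun_prop]
lemma continuous_heatKernel (t : ℝ) : Continuous (heatKernel d t) := by
  unfold heatKernel; fun_prop

@[fun_prop]
lemma continuous_gradKernel (i : Fin d) (t : ℝ) : Continuous (gradKernel d i t) := by
  unfold gradKernel; fun_prop

@[fun_prop]
lemma continuous_hessKernel (i j : Fin d) (t : ℝ) : Continuous (hessKernel d i j t) := by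
  unfold hessKernel; fun_prop

@[fun_prop]
lemma continuous_thirdKernel (i j k : Fin d) (t : ℝ) : Continuous (thirdKernel d i j k t) := by
  unfold thirdKernel; fun_prop

end Derivatives

/-! ### Gaussian bounds for the kernel and its derivatives -/

section Bounds

variable {d : ℕ}

lemma heatKernel_pos {t : ℝ} (ht : 0 < t) (z : EuclideanSpace ℝ (Fin d)) :
    0 < heatKernel d t z := by
  unfold heatKernel; positivity

lemma heatKernel_le {a b t : ℝ} (ha : 0 < a) (hat : a ≤ t) (htb : t ≤ b)
    (z : EuclideanSpace ℝ (Fin d)) :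
    heatKernel d t z ≤ (4 * Real.pi * a) ^ (-(d : ℝ) / 2) * Real.exp (-‖z‖ ^ 2 / (4 * b)) := by
  have ht : 0 < t := ha.trans_le hat
  unfold heatKernel
  refine mul_le_mul ?_ (Real.exp_le_exp.2 ?_) (by positivity) (by positivity)
  · apply Real.rpow_le_rpow_of_nonpos (by positivity)
    · gcongr
    · have : (0 : ℝ) ≤ d := by positivity
      linarith
  · rw [neg_div, neg_div, neg_le_neg_iff]
    gcongr

/-- The heat kernel with a slightly smaller rate of decay; it dominates the derivatives. -/
def envelopeKernel (d : ℕ) (b t : ℝ) (z : EuclideanSpace ℝ (Fin d)) : ℝ :=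
  Real.exp (‖z‖ ^ 2 / (32 * b)) * heatKernel d t z

lemma continuous_envelopeKernel (b t : ℝ) : Continuous (envelopeKernel d b t) := by
  unfold envelopeKernel; fun_prop

lemma envelopeKernel_nonneg {t : ℝ} (ht : 0 < t) (b : ℝ) (z : EuclideanSpace ℝ (Fin d)) :
    0 ≤ envelopeKernel d b t z :=
  mul_nonneg (Real.exp_nonneg _) (heatKernel_pos ht z).le

lemma heatKernel_le_envelopeKernel {b t : ℝ} (hb : 0 < b) (ht : 0 < t)
    (z : EuclideanSpace ℝ (Fin d)) : heatKernel d t z ≤ envelopeKernel d b t z := by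
  unfold envelopeKernel
  have : 1 ≤ Real.exp (‖z‖ ^ 2 / (32 * b)) := Real.one_le_exp (by positivity)
  nlinarith [heatKernel_pos ht z]

/-- This fixes the constant 32: the fourth power, needed later for Jensen's inequality, costs
4/(32b) = 1/(8b), half of the decay rate 1/(4b), so a Gaussian still remains. -/
lemma exp_mul_heatKernel_le {a b t : ℝ} (ha : 0 < a) (hat : a ≤ t) (htb : t ≤ b)
    (z : EuclideanSpace ℝ (Fin d)) :
    Real.exp (‖z‖ ^ 2 / (32 * b)) ^ 4 * heatKernel d t z
      ≤ (4 * Real.pi * a) ^ (-(d : ℝ) / 2) * Real.exp (-(1 / (8 * b)) * ‖z‖ ^ 2) := by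
  have hb : 0 < b := ha.trans_le (hat.trans htb)
  calc _ ≤ Real.exp (‖z‖ ^ 2 / (32 * b)) ^ 4 *
        ((4 * Real.pi * a) ^ (-(d : ℝ) / 2) * Real.exp (-‖z‖ ^ 2 / (4 * b))) := by
        gcongr; exact heatKernel_le ha hat htb z
    _ = _ := by
        rw [mul_left_comm, ← Real.exp_nat_mul, ← Real.exp_add]
        congr 2
        field_simp
        ring

lemma envelopeKernel_le {a b t : ℝ} (ha : 0 < a) (hat : a ≤ t) (htb : t ≤ b)
    (z : EuclideanSpace ℝ (Fin d)) :
    envelopeKernel d b t z ≤ (4 * Real.pi * a) ^ (-(d : ℝ) / 2) := by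
  have hb : 0 < b := ha.trans_le (hat.trans htb)
  have h1 : 1 ≤ Real.exp (‖z‖ ^ 2 / (32 * b)) := Real.one_le_exp (by positivity)
  calc envelopeKernel d b t z ≤ Real.exp (‖z‖ ^ 2 / (32 * b)) ^ 4 * heatKernel d t z := by
        unfold envelopeKernel
        have := heatKernel_pos (ha.trans_le hat) z
        gcongr
        exact le_self_pow₀ h1 (by norm_num)
    _ ≤ _ := exp_mul_heatKernel_le ha hat htb z
    _ ≤ (4 * Real.pi * a) ^ (-(d : ℝ) / 2) * 1 := by
        gcongr
        apply Real.exp_le_one_iff.2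
        have : 0 ≤ 1 / (8 * b) * ‖z‖ ^ 2 := by positivity
        linarith
    _ = _ := mul_one _

lemma exists_cube_le_exp {ε : ℝ} (hε : 0 < ε) :
    ∃ c : ℝ, 0 < c ∧ ∀ r : ℝ, 0 ≤ r → (1 + r) ^ 3 ≤ c * Real.exp (ε * r ^ 2) := by
  -- From 1 + r ≤ e^r, and 3r ≤ εr² + 9/(4ε) by completing the square.
  refine ⟨Real.exp (9 / (4 * ε)), Real.exp_pos _, fun r hr => ?_⟩
  have h1 : 1 + r ≤ Real.exp r := by linarith [Real.add_one_le_exp r]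
  calc (1 + r) ^ 3 ≤ Real.exp r ^ 3 := by gcongr
    _ = Real.exp (3 * r) := by rw [← Real.exp_nat_mul]; norm_num
    _ ≤ Real.exp (9 / (4 * ε) + ε * r ^ 2) := by
        apply Real.exp_le_exp.2
        have : 9 / (4 * ε) + ε * r ^ 2 - 3 * r = (3 - 2 * ε * r) ^ 2 / (4 * ε) := by
          field_simp; ring
        have : 0 ≤ (3 - 2 * ε * r) ^ 2 / (4 * ε) := by positivity
        linarith
    _ = _ := Real.exp_add _ _

lemma abs_apply_le_norm (z : EuclideanSpace ℝ (Fin d)) (i : Fin d) : |z i| ≤ ‖z‖ := by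
  simpa using PiLp.norm_apply_le z i

/-- The coefficients are polynomials of degree at most three in z and in 1/t, and 1/t ≤ 1/a. -/
lemma abs_kernelCoeff_le {a t : ℝ} (ha : 0 < a) (hat : a ≤ t) (z : EuclideanSpace ℝ (Fin d)) :
    (∀ i, |-(z i) / (2 * t)| ≤ (1 + 1 / a) ^ 3 * (1 + ‖z‖) ^ 3) ∧
    (∀ i j, |z i * z j / (4 * t ^ 2) - kroneckerDelta i j / (2 * t)|
      ≤ (1 + 1 / a) ^ 3 * (1 + ‖z‖) ^ 3) ∧
    ∀ i j k, |-(z i * z j * z k) / (8 * t ^ 3) + (kroneckerDelta i j * z k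
      + kroneckerDelta i k * z j + kroneckerDelta j k * z i) / (4 * t ^ 2)|
      ≤ (1 + 1 / a) ^ 3 * (1 + ‖z‖) ^ 3 := by
  have ht : 0 < t := ha.trans_le hat
  set r := ‖z‖
  have hr : 0 ≤ r := norm_nonneg z
  have hz : ∀ i, |z i| ≤ r := abs_apply_le_norm z
  set m := 1 / a
  have hm : 0 < m := by positivity
  set n := 1 / t
  have hn : 0 < n := by positivity
  have hnm : n ≤ m := one_div_le_one_div_of_le ha hat
  have hδ : ∀ i j : Fin d, |kroneckerDelta i j| ≤ 1 := abs_kroneckerDelta_le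
  refine ⟨fun i => ?_, fun i j => ?_, fun i j k => ?_⟩
  · have e : -(z i) / (2 * t) = -(1 / 2 * z i * n) := by simp only [n]; field_simp
    rw [e, abs_neg, abs_mul, abs_mul, abs_of_pos hn, abs_of_pos (by norm_num : (0 : ℝ) < 1 / 2)]
    calc 1 / 2 * |z i| * n ≤ 1 / 2 * r * m := by gcongr; exact hz i
      _ ≤ (1 + m) ^ 3 * (1 + r) ^ 3 := by
        have : 1 / 2 * r * m ≤ (1 + m) * (1 + r) := by nlinarith [mul_nonneg hm.le hr]
        calc _ ≤ (1 + m) * (1 + r) := this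
          _ ≤ (1 + m) ^ 3 * (1 + r) ^ 3 := by
            gcongr <;> exact le_self_pow₀ (by linarith) (by norm_num)
  · have e : z i * z j / (4 * t ^ 2) - kroneckerDelta i j / (2 * t)
      = 1 / 4 * z i * z j * n ^ 2 - 1 / 2 * kroneckerDelta i j * n := by simp only [n]; field_simp
    rw [e]
    have h1 : |1 / 4 * z i * z j * n ^ 2| ≤ 1 / 4 * r * r * m ^ 2 := by
      rw [abs_mul, abs_mul, abs_mul, abs_of_pos (by positivity : 0 < n ^ 2),
        abs_of_pos (by norm_num : (0 : ℝ) < 1 / 4)]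
      gcongr <;> apply hz
    have h2 : |1 / 2 * kroneckerDelta i j * n| ≤ 1 / 2 * 1 * m := by
      rw [abs_mul, abs_mul, abs_of_pos hn, abs_of_pos (by norm_num : (0 : ℝ) < 1 / 2)]
      gcongr; apply hδ
    calc _ ≤ 1 / 4 * r * r * m ^ 2 + 1 / 2 * 1 * m := (abs_sub _ _).trans (add_le_add h1 h2)
      _ ≤ (1 + m) ^ 2 * (1 + r) ^ 2 := by
        have : 0 ≤ m * r := by positivity
        have : 0 ≤ m * r ^ 2 := by positivity
        have : 0 ≤ m ^ 2 * r := by positivity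
        have : 0 ≤ m ^ 2 * r ^ 2 := by positivity
        nlinarith
      _ ≤ _ := by
        gcongr <;> linarith
  · have e : -(z i * z j * z k) / (8 * t ^ 3) + (kroneckerDelta i j * z k
      + kroneckerDelta i k * z j + kroneckerDelta j k * z i) / (4 * t ^ 2)
      = -(1 / 8 * z i * z j * z k * n ^ 3) + (1 / 4 * kroneckerDelta i j * z k * n ^ 2
        + 1 / 4 * kroneckerDelta i k * z j * n ^ 2 + 1 / 4 * kroneckerDelta j k * z i * n ^ 2) := by
      simp only [n]; field_simp
    rw [e]
    have h1 : |-(1 / 8 * z i * z j * z k * n ^ 3)| ≤ 1 / 8 * r * r * r * m ^ 3 := by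
      rw [abs_neg, abs_mul, abs_mul, abs_mul, abs_mul, abs_of_pos (by positivity : 0 < n ^ 3),
        abs_of_pos (by norm_num : (0 : ℝ) < 1 / 8)]
      gcongr <;> apply hz
    have h2 : ∀ i j k : Fin d, |1 / 4 * kroneckerDelta i j * z k * n ^ 2| ≤ 1 / 4 * 1 * r * m ^ 2 := by
      intro i j k
      rw [abs_mul, abs_mul, abs_mul, abs_of_pos (by positivity : 0 < n ^ 2),
        abs_of_pos (by norm_num : (0 : ℝ) < 1 / 4)]
      gcongr <;> first | apply hδ | apply hz
    calc _ ≤ 1 / 8 * r * r * r * m ^ 3 + (1 / 4 * 1 * r * m ^ 2 + 1 / 4 * 1 * r * m ^ 2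
          + 1 / 4 * 1 * r * m ^ 2) := by
          refine (abs_add_le _ _).trans (add_le_add h1 ((abs_add_le _ _).trans
            (add_le_add ((abs_add_le _ _).trans (add_le_add ?_ ?_)) ?_))) <;> apply h2
      _ ≤ (m * r) ^ 3 + m ^ 2 * r := by
        have : 0 ≤ (m * r) ^ 3 := by positivity
        have : 0 ≤ m ^ 2 * r := by positivity
        nlinarith
      _ ≤ ((1 + m) * (1 + r)) ^ 3 := by
        have h5 : 0 ≤ m * r := by positivity
        have h6 : m ^ 2 * r ≤ (1 + m * r + (m + r)) ^ 3 - (m * r) ^ 3 := by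
          have : (1 + m * r + (m + r)) ^ 3 - (m * r) ^ 3 - m ^ 2 * r
            = 1 + 3 * m + 3 * r + 9 * m * r + 3 * m ^ 2 + 3 * r ^ 2 + m ^ 3 + r ^ 3
              + 8 * m ^ 2 * r + 9 * m * r ^ 2 + 9 * m ^ 2 * r ^ 2
              + 3 * m ^ 3 * r + 3 * m * r ^ 3 + 3 * m ^ 3 * r ^ 2 + 3 * m ^ 2 * r ^ 3 := by ring
          have : 0 ≤ 1 + 3 * m + 3 * r + 9 * m * r + 3 * m ^ 2 + 3 * r ^ 2 + m ^ 3 + r ^ 3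
              + 8 * m ^ 2 * r + 9 * m * r ^ 2 + 9 * m ^ 2 * r ^ 2
              + 3 * m ^ 3 * r + 3 * m * r ^ 3 + 3 * m ^ 3 * r ^ 2 + 3 * m ^ 2 * r ^ 3 := by
            positivity
          linarith
        have h7 : (1 + m) * (1 + r) = 1 + m * r + (m + r) := by ring
        rw [h7]
        linarith
      _ = _ := by ring

/-- On a compact time interval the derivatives of the heat kernel up to order three are dominated
by a multiple of the envelope kernel. -/
lemma exists_kernel_bound (d : ℕ) {a b : ℝ} (ha : 0 < a) (hab : a ≤ b) :
    ∃ c : ℝ, 1 ≤ c ∧ ∀ t ∈ Icc a b, ∀ z : EuclideanSpace ℝ (Fin d),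
      heatKernel d t z ≤ c * envelopeKernel d b t z ∧
      (∀ i, |gradKernel d i t z| ≤ c * envelopeKernel d b t z) ∧
      (∀ i j, |hessKernel d i j t z| ≤ c * envelopeKernel d b t z) ∧
      ∀ i j k, |thirdKernel d i j k t z| ≤ c * envelopeKernel d b t z := by
  have hb : 0 < b := ha.trans_le hab
  obtain ⟨c, hc, hcr⟩ := exists_cube_le_exp (show 0 < 1 / (32 * b) by positivity)
  refine ⟨max 1 ((1 + 1 / a) ^ 3 * c), le_max_left _ _, fun t ht z => ?_⟩
  have ht0 : 0 < t := ha.trans_le ht.1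
  have hp := heatKernel_pos ht0 z
  have key : ∀ h : ℝ, |h| ≤ (1 + 1 / a) ^ 3 * (1 + ‖z‖) ^ 3 →
      |h * heatKernel d t z| ≤ max 1 ((1 + 1 / a) ^ 3 * c) * envelopeKernel d b t z := by
    intro h hh
    rw [abs_mul, abs_of_pos hp]
    calc |h| * heatKernel d t z
        ≤ (1 + 1 / a) ^ 3 * (c * Real.exp (1 / (32 * b) * ‖z‖ ^ 2)) * heatKernel d t z := by
          gcongr
          refine hh.trans ?_
          gcongr
          exact hcr _ (norm_nonneg z)
      _ = (1 + 1 / a) ^ 3 * c * envelopeKernel d b t z := by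
          rw [envelopeKernel, one_div_mul_eq_div]; ring
      _ ≤ _ := by
          have := envelopeKernel_nonneg ht0 b z
          gcongr
          exact le_max_right _ _
  obtain ⟨h1, h2, h3⟩ := abs_kernelCoeff_le ha ht.1 z
  refine ⟨?_, fun i => key _ (h1 i), fun i j => key _ (h2 i j), fun i j k => key _ (h3 i j k)⟩
  have := envelopeKernel_nonneg ht0 b z
  calc _ ≤ 1 * envelopeKernel d b t z := by
        rw [one_mul]; exact heatKernel_le_envelopeKernel hb ht0 z
    _ ≤ _ := by gcongr; exact le_max_left _ _

end Bounds

/-! ### Averages of translated kernels over a probability measure -/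

section Average

variable {d : ℕ}

/-- The average `x ↦ ∫ k (x - y) dμ(y)` of the translates of a kernel, i.e. `k * μ`. -/
def kernelAverage (μ : Measure (EuclideanSpace ℝ (Fin d))) (k : EuclideanSpace ℝ (Fin d) → ℝ)
    (x : EuclideanSpace ℝ (Fin d)) : ℝ :=
  ∫ y, k (x - y) ∂μ

variable {μ : Measure (EuclideanSpace ℝ (Fin d))}

lemma kernelAverage_const_mul (c : ℝ) (k : EuclideanSpace ℝ (Fin d) → ℝ)
    (x : EuclideanSpace ℝ (Fin d)) :
    kernelAverage μ (fun z => c * k z) x = c * kernelAverage μ k x :=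
  integral_const_mul _ _

variable [IsProbabilityMeasure μ]

lemma integrable_translate {k : EuclideanSpace ℝ (Fin d) → ℝ} (hk : Continuous k) {C : ℝ}
    (hC : ∀ z, |k z| ≤ C) (x : EuclideanSpace ℝ (Fin d)) : Integrable (fun y => k (x - y)) μ :=
  Integrable.of_bound (by fun_prop) C (ae_of_all _ fun y => hC _)

lemma continuous_kernelAverage {k : EuclideanSpace ℝ (Fin d) → ℝ} (hk : Continuous k) {C : ℝ}
    (hC : ∀ z, |k z| ≤ C) : Continuous (kernelAverage μ k) := by
  unfold kernelAverage
  exact continuous_of_dominated (bound := fun _ => C) (fun x => by fun_prop)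
    (fun x => ae_of_all _ fun y => hC _) (integrable_const C) (ae_of_all _ fun y => by fun_prop)

lemma hasDerivAt_kernelAverage {k k' : ℝ → EuclideanSpace ℝ (Fin d) → ℝ} {s₀ : ℝ} {S : Set ℝ}
    (hS : S ∈ 𝓝 s₀) (hk : ∀ s ∈ S, Continuous (k s)) (hk' : Continuous (k' s₀)) {C C' : ℝ}
    (hC : ∀ z, |k s₀ z| ≤ C) (hC' : ∀ s ∈ S, ∀ z, |k' s z| ≤ C')
    (hd : ∀ s ∈ S, ∀ z, HasDerivAt (fun s => k s z) (k' s z) s) (x : EuclideanSpace ℝ (Fin d)) :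
    HasDerivAt (fun s => kernelAverage μ (k s) x) (kernelAverage μ (k' s₀) x) s₀ := by
  have h0 : s₀ ∈ S := mem_of_mem_nhds hS
  refine (hasDerivAt_integral_of_dominated_loc_of_deriv_le (μ := μ) (bound := fun _ => C') hS
    (F := fun s y => k s (x - y)) (F' := fun s y => k' s (x - y)) ?_
    (integrable_translate (hk _ h0) hC x) ?_ ?_ (integrable_const _) ?_).2
  · filter_upwards [hS] with s hs
    have := hk s hs
    fun_prop
  · fun_prop
  · exact ae_of_all _ fun y s hs => hC' s hs _
  · exact ae_of_all _ fun y s hs => hd s hs _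

/-- Moving x along e is the same as moving the kernel, so this is differentiation in a parameter
with s ↦ k(· + s e) as the family. -/
lemma hasLineDerivAt_kernelAverage {k k' : EuclideanSpace ℝ (Fin d) → ℝ}
    {e : EuclideanSpace ℝ (Fin d)} (hk : Continuous k) (hk' : Continuous k') {C C' : ℝ}
    (hC : ∀ z, |k z| ≤ C) (hC' : ∀ z, |k' z| ≤ C')
    (hd : ∀ z, ∀ s : ℝ, HasDerivAt (fun s : ℝ => k (z + s • e)) (k' (z + s • e)) s)
    (x : EuclideanSpace ℝ (Fin d)) :
    HasLineDerivAt ℝ (kernelAverage μ k) (kernelAverage μ k' x) x e := by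
  have h := hasDerivAt_kernelAverage (μ := μ) (k := fun s z => k (z + s • e))
    (k' := fun s z => k' (z + s • e)) (s₀ := 0) (S := univ) univ_mem (fun s _ => by fun_prop)
    (by fun_prop) (fun z => hC _) (fun s _ z => hC' _) (fun s _ z => hd z s) x
  have e1 : kernelAverage μ (fun z => k' (z + (0 : ℝ) • e)) x = kernelAverage μ k' x := by
    simp
  have e2 : (fun s : ℝ => kernelAverage μ (fun z => k (z + s • e)) x)
      = fun s => kernelAverage μ k (x + s • e) := by
    funext s
    simp only [kernelAverage]
    congr 1
    funext y
    congr 1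
    abel
  rw [e1, e2] at h
  exact h

lemma kernelAverage_sum {ι : Type*} (s : Finset ι) {k : ι → EuclideanSpace ℝ (Fin d) → ℝ}
    (hk : ∀ i, Continuous (k i)) {C : ℝ} (hC : ∀ i z, |k i z| ≤ C)
    (x : EuclideanSpace ℝ (Fin d)) :
    kernelAverage μ (fun z => ∑ i ∈ s, k i z) x = ∑ i ∈ s, kernelAverage μ (k i) x :=
  integral_finsetSum _ fun i _ => integrable_translate (hk i) (hC i) x

lemma abs_kernelAverage_le {k l : EuclideanSpace ℝ (Fin d) → ℝ}
    (hl : Continuous l) {C : ℝ} (hlC : ∀ z, |l z| ≤ C)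
    (h : ∀ z, |k z| ≤ l z) (x : EuclideanSpace ℝ (Fin d)) :
    |kernelAverage μ k x| ≤ kernelAverage μ l x :=
  norm_integral_le_of_norm_le (f := fun y => k (x - y)) (integrable_translate hl hlC x)
    (ae_of_all _ fun y => h (x - y))

lemma kernelAverage_le_const {k : EuclideanSpace ℝ (Fin d) → ℝ} (hk : Continuous k) {C : ℝ}
    (hC : ∀ z, |k z| ≤ C) (x : EuclideanSpace ℝ (Fin d)) : kernelAverage μ k x ≤ C := by
  have := integral_mono (μ := μ) (integrable_translate hk hC x) (integrable_const C)
    fun y => (le_abs_self _).trans (hC (x - y))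
  simpa [kernelAverage] using this

lemma kernelAverage_pos {k : EuclideanSpace ℝ (Fin d) → ℝ} (hk : Continuous k) {C : ℝ}
    (hC : ∀ z, |k z| ≤ C) (hpos : ∀ z, 0 < k z) (x : EuclideanSpace ℝ (Fin d)) :
    0 < kernelAverage μ k x := by
  unfold kernelAverage
  rw [integral_pos_iff_support_of_nonneg (fun y => (hpos _).le) (integrable_translate hk hC x)]
  have : Function.support (fun y => k (x - y)) = univ := by
    ext y; simpa using (hpos (x - y)).ne'
  simp [this]

/-- Tonelli: translation preserves the L¹ norm of `k`, and μ is finite. -/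
lemma integrable_kernelAverage {k : EuclideanSpace ℝ (Fin d) → ℝ} (hk : Continuous k)
    (hi : Integrable k) : Integrable (kernelAverage μ k) := by
  have hm : AEStronglyMeasurable
      (Function.uncurry fun x y : EuclideanSpace ℝ (Fin d) => k (x - y)) (volume.prod μ) := by
    apply Continuous.aestronglyMeasurable
    fun_prop
  have h : Integrable (Function.uncurry fun x y : EuclideanSpace ℝ (Fin d) => k (x - y))
      (volume.prod μ) := by
    rw [integrable_prod_iff' hm]
    refine ⟨ae_of_all _ fun y => hi.comp_sub_right y, ?_⟩
    have : (fun y : EuclideanSpace ℝ (Fin d) => ∫ x, ‖Function.uncurry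
        (fun x y : EuclideanSpace ℝ (Fin d) => k (x - y)) (x, y)‖) = fun _ => ∫ x, ‖k x‖ := by
      funext y
      exact integral_sub_right_eq_self (fun x => ‖k x‖) y
    rw [this]
    exact integrable_const _
  exact h.integral_prod_left

/-- Jensen's inequality for the fourth power and the density `h` with respect to `k`. -/
lemma kernelAverage_pow_four_le {h k : EuclideanSpace ℝ (Fin d) → ℝ} (hh : Continuous h)
    (hk : Continuous k) {C : ℝ} (hkC : ∀ z, |k z| ≤ C)
    (hhC : ∀ z, |h z * k z| ≤ C) (hh4C : ∀ z, |h z ^ 4 * k z| ≤ C) (hpos : ∀ z, 0 < k z)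
    (x : EuclideanSpace ℝ (Fin d)) :
    kernelAverage μ (fun z => h z * k z) x ^ 4
      ≤ kernelAverage μ k x ^ 3 * kernelAverage μ (fun z => h z ^ 4 * k z) x := by
  have hu := kernelAverage_pos (μ := μ) hk hkC hpos x
  set u := kernelAverage μ k x with hu_def
  set W := kernelAverage μ (fun z => h z * k z) x with hW_def
  set r := W / u
  have i1 := integrable_translate (μ := μ) hk hkC x
  have i2 := integrable_translate (μ := μ) (k := fun z => h z * k z) (by fun_prop) hhC x
  have i3 := integrable_translate (μ := μ) (k := fun z => h z ^ 4 * k z) (by fun_prop) hh4C x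
  -- The convex function s⁴ lies above its tangent at the weighted mean r = W/u.
  have key : ∀ y : EuclideanSpace ℝ (Fin d), 4 * r ^ 3 * (h (x - y) * k (x - y))
      - 3 * r ^ 4 * k (x - y) ≤ h (x - y) ^ 4 * k (x - y) := by
    intro y
    have h1 : 0 ≤ h (x - y) ^ 4 - 4 * r ^ 3 * h (x - y) + 3 * r ^ 4 := by
      have : h (x - y) ^ 4 - 4 * r ^ 3 * h (x - y) + 3 * r ^ 4
        = (h (x - y) - r) ^ 2 * ((h (x - y) + r) ^ 2 + 2 * r ^ 2) := by ring
      rw [this]; positivity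
    nlinarith [mul_nonneg h1 (hpos (x - y)).le]
  have hint := integral_mono ((i2.const_mul (4 * r ^ 3)).sub (i1.const_mul (3 * r ^ 4))) i3 key
  have e : ∫ y, (4 * r ^ 3 * (h (x - y) * k (x - y)) - 3 * r ^ 4 * k (x - y)) ∂μ
      = 4 * r ^ 3 * W - 3 * r ^ 4 * u := by
    rw [integral_sub (i2.const_mul _) (i1.const_mul _), integral_const_mul, integral_const_mul]
    rfl
  have hle : 4 * r ^ 3 * W - 3 * r ^ 4 * u ≤ kernelAverage μ (fun z => h z ^ 4 * k z) x :=
    e.symm.trans_le hint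
  have hW : W = r * u := by simp only [r]; field_simp
  calc W ^ 4 = u ^ 3 * (4 * r ^ 3 * W - 3 * r ^ 4 * u) := by rw [hW]; ring
    _ ≤ _ := by gcongr

end Average

/-! ### The heat flow, its derivatives and the integrable envelope -/

section Flow

variable {d : ℕ} (μ : Measure (EuclideanSpace ℝ (Fin d)))

/-- The heat flow started from a measure. -/
def heatSol (t : ℝ) (x : EuclideanSpace ℝ (Fin d)) : ℝ := kernelAverage μ (heatKernel d t) x

/-- First partial derivatives of the heat flow. -/
def heatGrad (i : Fin d) (t : ℝ) (x : EuclideanSpace ℝ (Fin d)) : ℝ :=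
  kernelAverage μ (gradKernel d i t) x

/-- Second partial derivatives of the heat flow. -/
def heatHess (i j : Fin d) (t : ℝ) (x : EuclideanSpace ℝ (Fin d)) : ℝ :=
  kernelAverage μ (hessKernel d i j t) x

/-- Third partial derivatives of the heat flow. -/
def heatThird (i j k : Fin d) (t : ℝ) (x : EuclideanSpace ℝ (Fin d)) : ℝ :=
  kernelAverage μ (thirdKernel d i j k t) x

lemma heatHess_comm (i j : Fin d) (t : ℝ) (x : EuclideanSpace ℝ (Fin d)) :
    heatHess μ i j t x = heatHess μ j i t x := by
  simp only [heatHess, kernelAverage, hessKernel_comm i j]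

lemma heatThird_comm_left (i j k : Fin d) (t : ℝ) (x : EuclideanSpace ℝ (Fin d)) :
    heatThird μ i j k t x = heatThird μ j i k t x := by
  simp only [heatThird, kernelAverage, thirdKernel_comm_left i j]

lemma heatThird_comm_right (i j k : Fin d) (t : ℝ) (x : EuclideanSpace ℝ (Fin d)) :
    heatThird μ i j k t x = heatThird μ i k j t x := by
  simp only [heatThird, kernelAverage, thirdKernel_comm_right i j]

/-- On a compact time interval the derivatives of the heat kernel are uniformly bounded. -/
lemma exists_kernel_unif_bound (d : ℕ) {a b : ℝ} (ha : 0 < a) (hab : a ≤ b) :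
    ∃ C : ℝ, ∀ t ∈ Icc a b, ∀ z : EuclideanSpace ℝ (Fin d), |heatKernel d t z| ≤ C ∧
      (∀ i, |gradKernel d i t z| ≤ C) ∧ (∀ i j, |hessKernel d i j t z| ≤ C) ∧
      ∀ i j k, |thirdKernel d i j k t z| ≤ C := by
  obtain ⟨c, hc, h⟩ := exists_kernel_bound d ha hab
  refine ⟨c * (4 * Real.pi * a) ^ (-(d : ℝ) / 2), fun t ht z => ?_⟩
  obtain ⟨h0, h1, h2, h3⟩ := h t ht z
  have hle : c * envelopeKernel d b t z ≤ c * (4 * Real.pi * a) ^ (-(d : ℝ) / 2) := by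
    gcongr
    exact envelopeKernel_le ha ht.1 ht.2 z
  refine ⟨?_, fun i => (h1 i).trans hle, fun i j => (h2 i j).trans hle,
    fun i j k => (h3 i j k).trans hle⟩
  rw [abs_of_pos (heatKernel_pos (ha.trans_le ht.1) z)]
  exact h0.trans hle

variable [IsProbabilityMeasure μ]

lemma heatSol_pos {t : ℝ} (ht : 0 < t) (x : EuclideanSpace ℝ (Fin d)) : 0 < heatSol μ t x := by
  obtain ⟨C, hC⟩ := exists_kernel_unif_bound d ht le_rfl
  exact kernelAverage_pos (continuous_heatKernel t) (fun z => (hC t ⟨le_rfl, le_rfl⟩ z).1)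
    (heatKernel_pos ht) x

lemma continuous_heatSol {t : ℝ} (ht : 0 < t) : Continuous (heatSol μ t) := by
  obtain ⟨C, hC⟩ := exists_kernel_unif_bound d ht le_rfl
  exact continuous_kernelAverage (continuous_heatKernel t) (fun z => (hC t ⟨le_rfl, le_rfl⟩ z).1)

lemma continuous_heatGrad (i : Fin d) {t : ℝ} (ht : 0 < t) : Continuous (heatGrad μ i t) := by
  obtain ⟨C, hC⟩ := exists_kernel_unif_bound d ht le_rfl
  exact continuous_kernelAverage (continuous_gradKernel i t)
    (fun z => (hC t ⟨le_rfl, le_rfl⟩ z).2.1 i)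

lemma continuous_heatHess (i j : Fin d) {t : ℝ} (ht : 0 < t) :
    Continuous (heatHess μ i j t) := by
  obtain ⟨C, hC⟩ := exists_kernel_unif_bound d ht le_rfl
  exact continuous_kernelAverage (continuous_hessKernel i j t)
    (fun z => (hC t ⟨le_rfl, le_rfl⟩ z).2.2.1 i j)

lemma continuous_heatThird (i j k : Fin d) {t : ℝ} (ht : 0 < t) :
    Continuous (heatThird μ i j k t) := by
  obtain ⟨C, hC⟩ := exists_kernel_unif_bound d ht le_rfl
  exact continuous_kernelAverage (continuous_thirdKernel i j k t)
    (fun z => (hC t ⟨le_rfl, le_rfl⟩ z).2.2.2 i j k)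

lemma hasLineDerivAt_heatSol (i : Fin d) {t : ℝ} (ht : 0 < t) (x : EuclideanSpace ℝ (Fin d)) :
    HasLineDerivAt ℝ (heatSol μ t) (heatGrad μ i t x) x (EuclideanSpace.single i (1 : ℝ)) := by
  obtain ⟨C, hC⟩ := exists_kernel_unif_bound d ht le_rfl
  have hC := hC t ⟨le_rfl, le_rfl⟩
  exact hasLineDerivAt_kernelAverage (by fun_prop) (by fun_prop) (fun z => (hC z).1)
    (fun z => (hC z).2.1 i) (hasDerivAt_line_heatKernel i ht) x

lemma hasLineDerivAt_heatGrad (i l : Fin d) {t : ℝ} (ht : 0 < t)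
    (x : EuclideanSpace ℝ (Fin d)) :
    HasLineDerivAt ℝ (heatGrad μ i t) (heatHess μ i l t x) x
      (EuclideanSpace.single l (1 : ℝ)) := by
  obtain ⟨C, hC⟩ := exists_kernel_unif_bound d ht le_rfl
  have hC := hC t ⟨le_rfl, le_rfl⟩
  exact hasLineDerivAt_kernelAverage (by fun_prop) (by fun_prop) (fun z => (hC z).2.1 i)
    (fun z => (hC z).2.2.1 i l) (hasDerivAt_line_gradKernel i l ht) x

lemma hasLineDerivAt_heatHess (i j l : Fin d) {t : ℝ} (ht : 0 < t)
    (x : EuclideanSpace ℝ (Fin d)) :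
    HasLineDerivAt ℝ (heatHess μ i j t) (heatThird μ i j l t x) x
      (EuclideanSpace.single l (1 : ℝ)) := by
  obtain ⟨C, hC⟩ := exists_kernel_unif_bound d ht le_rfl
  have hC := hC t ⟨le_rfl, le_rfl⟩
  exact hasLineDerivAt_kernelAverage (by fun_prop) (by fun_prop) (fun z => (hC z).2.2.1 i j)
    (fun z => (hC z).2.2.2 i j l) (hasDerivAt_line_hessKernel i j l ht) x

lemma abs_finsetSum_le_card_mul {ι : Type*} (s : Finset ι) {f : ι → ℝ} {C : ℝ}
    (h : ∀ i, |f i| ≤ C) : |∑ i ∈ s, f i| ≤ s.card * C := by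
  calc |∑ i ∈ s, f i| ≤ ∑ i ∈ s, |f i| := Finset.abs_sum_le_sum_abs _ _
    _ ≤ s.card • C := Finset.sum_le_card_nsmul _ _ _ fun i _ => h i
    _ = _ := nsmul_eq_mul _ _

lemma hasDerivAt_heatSol {t : ℝ} (ht : 0 < t) (x : EuclideanSpace ℝ (Fin d)) :
    HasDerivAt (fun t => heatSol μ t x) (∑ j, heatHess μ j j t x) t := by
  have hab : t / 2 ≤ 2 * t := by linarith
  obtain ⟨C, hC⟩ := exists_kernel_unif_bound d (half_pos ht) hab
  have hmem : Icc (t / 2) (2 * t) ∈ 𝓝 t := Icc_mem_nhds (by linarith) (by linarith)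
  have hC0 := hC t (mem_of_mem_nhds hmem)
  refine (hasDerivAt_kernelAverage (k := heatKernel d)
    (k' := fun t z => ∑ j, hessKernel d j j t z) hmem
    (fun s _ => by fun_prop) (by fun_prop) (fun z => (hC0 z).1)
    (fun s hs z => abs_finsetSum_le_card_mul _ fun j => (hC s hs z).2.2.1 j j)
    (fun s hs z => hasDerivAt_time_heatKernel z (by linarith [hs.1])) x).congr_deriv ?_
  exact kernelAverage_sum _ (fun i => by fun_prop) (fun i z => (hC0 z).2.2.1 i i) x

lemma hasDerivAt_heatGrad (i : Fin d) {t : ℝ} (ht : 0 < t) (x : EuclideanSpace ℝ (Fin d)) :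
    HasDerivAt (fun t => heatGrad μ i t x) (∑ j, heatThird μ i j j t x) t := by
  have hab : t / 2 ≤ 2 * t := by linarith
  obtain ⟨C, hC⟩ := exists_kernel_unif_bound d (half_pos ht) hab
  have hmem : Icc (t / 2) (2 * t) ∈ 𝓝 t := Icc_mem_nhds (by linarith) (by linarith)
  have hC0 := hC t (mem_of_mem_nhds hmem)
  refine (hasDerivAt_kernelAverage (k := gradKernel d i)
    (k' := fun t z => ∑ j, thirdKernel d i j j t z) hmem
    (fun s _ => by fun_prop) (by fun_prop) (fun z => (hC0 z).2.1 i)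
    (fun s hs z => abs_finsetSum_le_card_mul _ fun j => (hC s hs z).2.2.2 i j j)
    (fun s hs z => hasDerivAt_time_gradKernel i z (by linarith [hs.1])) x).congr_deriv ?_
  exact kernelAverage_sum _ (fun j => by fun_prop) (fun j z => (hC0 z).2.2.2 i j j) x

lemma integrable_exp_neg_mul_norm_sq {c : ℝ} (hc : 0 < c) :
    Integrable (fun z : EuclideanSpace ℝ (Fin d) => Real.exp (-c * ‖z‖ ^ 2)) := by
  have h := GaussianFourier.integrable_cexp_neg_mul_sq_norm_add (b := (c : ℂ)) (by simpa using hc) 0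
    (0 : EuclideanSpace ℝ (Fin d))
  refine h.re.congr (ae_of_all _ fun z => ?_)
  simp only [zero_mul, add_zero]
  have : (-(c : ℂ) * (‖z‖ : ℂ) ^ 2) = ((-c * ‖z‖ ^ 2 : ℝ) : ℂ) := by push_cast; ring
  rw [this]
  exact Complex.exp_ofReal_re _

/-- On a compact time interval the heat flow and its derivatives are dominated by a function `W`
for which `u ^ (q - 4) * W ^ 4` has an integrable majorant, uniformly in `q ∈ [1, 3]`. -/
lemma exists_envelope {a b : ℝ} (ha : 0 < a) (hab : a ≤ b) :
    ∃ (W : ℝ → EuclideanSpace ℝ (Fin d) → ℝ) (B : EuclideanSpace ℝ (Fin d) → ℝ) (M : ℝ),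
      Integrable B ∧ ∀ t ∈ Icc a b, ∀ x, heatSol μ t x ≤ W t x ∧ heatSol μ t x ≤ M ∧
        (∀ i, |heatGrad μ i t x| ≤ W t x) ∧ (∀ i j, |heatHess μ i j t x| ≤ W t x) ∧
        (∀ i j k, |heatThird μ i j k t x| ≤ W t x) ∧
        ∀ q ∈ Icc (1 : ℝ) 3, heatSol μ t x ^ (q - 4) * W t x ^ 4 ≤ B x := by
  have hb : 0 < b := ha.trans_le hab
  obtain ⟨c, hc, hbd⟩ := exists_kernel_bound d ha hab
  set m := (4 * Real.pi * a) ^ (-(d : ℝ) / 2)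
  have hm : 0 < m := by positivity
  set M := max 1 m
  have hM : 1 ≤ M := le_max_left _ _
  have hmM : m ≤ M := le_max_right _ _
  set G : EuclideanSpace ℝ (Fin d) → ℝ := fun z => Real.exp (-(1 / (8 * b)) * ‖z‖ ^ 2)
  have hG : Continuous G := by fun_prop
  have hG1 : ∀ z, G z ≤ 1 := by
    intro z
    apply Real.exp_le_one_iff.2
    have : 0 ≤ 1 / (8 * b) * ‖z‖ ^ 2 := by positivity
    linarith
  have hG0 : ∀ z, 0 ≤ G z := fun z => Real.exp_nonneg _
  have hGi : Integrable G := integrable_exp_neg_mul_norm_sq (by positivity)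
  refine ⟨fun t x => c * kernelAverage μ (envelopeKernel d b t) x,
    fun x => M ^ 2 * c ^ 4 * m * kernelAverage μ G x, M,
    (integrable_kernelAverage hG hGi).const_mul _, fun t ht x => ?_⟩
  have ht0 : 0 < t := ha.trans_le ht.1
  have hN0 := envelopeKernel_nonneg (d := d) ht0 b
  have hNm : ∀ z : EuclideanSpace ℝ (Fin d), envelopeKernel d b t z ≤ m :=
    envelopeKernel_le ha ht.1 ht.2
  have hNc := continuous_envelopeKernel (d := d) b t
  have hcN : ∀ z : EuclideanSpace ℝ (Fin d), |c * envelopeKernel d b t z| ≤ c * m := fun z => by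
    rw [abs_of_nonneg (mul_nonneg (by linarith) (hN0 z))]
    gcongr
    exact hNm z
  have hpm : ∀ z : EuclideanSpace ℝ (Fin d), |heatKernel d t z| ≤ m := fun z => by
    rw [abs_of_pos (heatKernel_pos ht0 z)]
    exact (heatKernel_le_envelopeKernel hb ht0 z).trans (hNm z)
  have hdom : ∀ k : EuclideanSpace ℝ (Fin d) → ℝ, (∀ z, |k z| ≤ c * envelopeKernel d b t z) →
      |kernelAverage μ k x| ≤ c * kernelAverage μ (envelopeKernel d b t) x := by
    intro k hk
    rw [← kernelAverage_const_mul]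
    exact abs_kernelAverage_le (by fun_prop) hcN hk x
  have hu := heatSol_pos μ ht0 x
  have huM : heatSol μ t x ≤ M :=
    (kernelAverage_le_const (continuous_heatKernel t) hpm x).trans hmM
  have hE4 : ∀ z : EuclideanSpace ℝ (Fin d), Real.exp (‖z‖ ^ 2 / (32 * b)) ^ 4 * heatKernel d t z
      ≤ m * G z := exp_mul_heatKernel_le ha ht.1 ht.2
  have hE4n : ∀ z : EuclideanSpace ℝ (Fin d),
      |Real.exp (‖z‖ ^ 2 / (32 * b)) ^ 4 * heatKernel d t z| ≤ m * G z := by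
    intro z
    rw [abs_of_nonneg]
    · exact hE4 z
    · have := heatKernel_pos ht0 z
      positivity
  have hmG : ∀ z, |m * G z| ≤ m := by
    intro z
    rw [abs_of_nonneg (mul_nonneg hm.le (hG0 z))]
    nlinarith [hG1 z]
  -- Jensen with the weight exp(|z|²/(32b)). The factor u³ is what turns the singular power u^(q-4)
  -- into u^(q-1).
  have hJ : kernelAverage μ (envelopeKernel d b t) x ^ 4
      ≤ heatSol μ t x ^ 3 * (m * kernelAverage μ G x) := by
    calc _ ≤ heatSol μ t x ^ 3 * kernelAverage μ
          (fun z => Real.exp (‖z‖ ^ 2 / (32 * b)) ^ 4 * heatKernel d t z) x := by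
          refine kernelAverage_pow_four_le (h := fun z => Real.exp (‖z‖ ^ 2 / (32 * b)))
            (by fun_prop) (continuous_heatKernel t) (C := m) hpm ?_ ?_ (heatKernel_pos ht0) x
          · intro z
            exact (abs_of_nonneg (hN0 z)).trans_le (hNm z)
          · exact fun z => (hE4n z).trans ((le_abs_self _).trans (hmG z))
      _ ≤ _ := by
        rw [← kernelAverage_const_mul m G]
        gcongr
        exact (le_abs_self _).trans (abs_kernelAverage_le (by fun_prop) hmG hE4n x)
  refine ⟨(le_abs_self _).trans (hdom _ fun z => ?_), huM, fun i => hdom _ fun z => (hbd t ht z).2.1 i,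
    fun i j => hdom _ fun z => (hbd t ht z).2.2.1 i j,
    fun i j k => hdom _ fun z => (hbd t ht z).2.2.2 i j k, fun q hq => ?_⟩
  · rw [abs_of_pos (heatKernel_pos ht0 z)]
    exact (hbd t ht z).1
  -- Here 1 ≤ q ≤ 3 enters: 0 ≤ q - 1 ≤ 2, and M ≥ 1 makes M² a bound independent of q.
  · have hq1 : heatSol μ t x ^ (q - 1) ≤ M ^ 2 := by
      calc heatSol μ t x ^ (q - 1) ≤ M ^ (q - 1) := by
            apply Real.rpow_le_rpow hu.le huM; linarith [hq.1]
        _ ≤ M ^ (2 : ℝ) := Real.rpow_le_rpow_of_exponent_le hM (by linarith [hq.2])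
        _ = M ^ 2 := by norm_cast
    have hG' : 0 ≤ kernelAverage μ G x := integral_nonneg fun y => hG0 _
    calc heatSol μ t x ^ (q - 4) * (c * kernelAverage μ (envelopeKernel d b t) x) ^ 4
        = heatSol μ t x ^ (q - 4) * (c ^ 4 * kernelAverage μ (envelopeKernel d b t) x ^ 4) := by
          ring
      _ ≤ heatSol μ t x ^ (q - 4) * (c ^ 4 * (heatSol μ t x ^ 3 * (m * kernelAverage μ G x))) := by
          gcongr
      _ = (heatSol μ t x ^ (q - 4) * heatSol μ t x ^ 3) * (c ^ 4 * (m * kernelAverage μ G x)) := by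
          ring
      _ = heatSol μ t x ^ (q - 1) * (c ^ 4 * (m * kernelAverage μ G x)) := by
          rw [← Real.rpow_add_natCast hu.ne']
          congr 2
          push_cast
          ring
      _ ≤ M ^ 2 * (c ^ 4 * (m * kernelAverage μ G x)) := by gcongr
      _ = _ := by ring

end Flow

/-! ### Integrability of homogeneous expressions, and integration by parts -/

section Integrability

variable {d : ℕ} {μ : Measure (EuclideanSpace ℝ (Fin d))}

/-- The heat flow at time `t` and its spatial derivatives of order at most three. -/
inductive IsHeatDerivative (μ : Measure (EuclideanSpace ℝ (Fin d))) (t : ℝ) :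
    (EuclideanSpace ℝ (Fin d) → ℝ) → Prop
  | sol : IsHeatDerivative μ t (heatSol μ t)
  | grad (i : Fin d) : IsHeatDerivative μ t (heatGrad μ i t)
  | hess (i j : Fin d) : IsHeatDerivative μ t (heatHess μ i j t)
  | third (i j k : Fin d) : IsHeatDerivative μ t (heatThird μ i j k t)

/-- Trading factors u for the larger W reduces products with fewer derivatives to the quartic bound
of `exists_envelope`. -/
lemma rpow_sub_nat_mul_pow_le {u W : ℝ} (hu : 0 < u) (huW : u ≤ W) (q : ℝ) {n : ℕ} (hn : n ≤ 4) :
    u ^ (q - n) * W ^ n ≤ u ^ (q - 4) * W ^ 4 := by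
  have e : u ^ (q - n) = u ^ (q - 4) * u ^ (4 - n) := by
    rw [← Real.rpow_add_natCast hu.ne', Nat.cast_sub hn]
    congr 1
    push_cast
    ring
  rw [e, mul_assoc]
  gcongr
  calc u ^ (4 - n) * W ^ n ≤ W ^ (4 - n) * W ^ n := by
        have : 0 < W := hu.trans_le huW
        gcongr
    _ = W ^ 4 := by rw [← pow_add]; congr 1; omega

variable [IsProbabilityMeasure μ]

lemma IsHeatDerivative.continuous {t : ℝ} (ht : 0 < t) {f : EuclideanSpace ℝ (Fin d) → ℝ}
    (hf : IsHeatDerivative μ t f) : Continuous f := by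
  cases hf with
  | sol => exact continuous_heatSol μ ht
  | grad i => exact continuous_heatGrad μ i ht
  | hess i j => exact continuous_heatHess μ i j ht
  | third i j k => exact continuous_heatThird μ i j k ht

lemma continuous_heatSol_rpow {t : ℝ} (ht : 0 < t) (r : ℝ) :
    Continuous fun x => heatSol μ t x ^ r :=
  (continuous_heatSol μ ht).rpow_const fun x => Or.inl (heatSol_pos μ ht x).ne'

/-- Each factor is at most W, so the envelope applies directly. Since u itself is an admissible
factor, the cubic, quadratic and linear versions follow by inserting u. -/
lemma integrable_heat_quartic {t q : ℝ} (ht : 0 < t) (hq : q ∈ Icc (1 : ℝ) 3)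
    {f g h k : EuclideanSpace ℝ (Fin d) → ℝ} (hf : IsHeatDerivative μ t f)
    (hg : IsHeatDerivative μ t g) (hh : IsHeatDerivative μ t h) (hk : IsHeatDerivative μ t k) :
    Integrable fun x => heatSol μ t x ^ (q - 4) * (f x * g x * h x * k x) := by
  obtain ⟨W, B, M, hB, hW⟩ := exists_envelope μ ht le_rfl
  have hW := hW t ⟨le_rfl, le_rfl⟩
  have hc := continuous_heatSol_rpow (μ := μ) ht (q - 4)
  have hf' := hf.continuous ht
  have hg' := hg.continuous ht
  have hh' := hh.continuous ht
  have hk' := hk.continuous ht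
  have bound : ∀ {f : EuclideanSpace ℝ (Fin d) → ℝ}, IsHeatDerivative μ t f →
      ∀ x, |f x| ≤ W t x := by
    intro f hf x
    obtain ⟨h0, -, h1, h2, h3, -⟩ := hW x
    cases hf with
    | sol => rwa [abs_of_pos (heatSol_pos μ ht x)]
    | grad i => exact h1 i
    | hess i j => exact h2 i j
    | third i j k => exact h3 i j k
  refine hB.mono' (Continuous.aestronglyMeasurable (by fun_prop)) (ae_of_all _ fun x => ?_)
  have hu := heatSol_pos μ ht x
  have hWx : 0 ≤ W t x := hu.le.trans (hW x).1
  rw [Real.norm_eq_abs, abs_mul, abs_of_pos (by positivity), abs_mul, abs_mul, abs_mul]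
  refine le_trans ?_ ((hW x).2.2.2.2.2 q hq)
  have e : W t x ^ 4 = W t x * W t x * W t x * W t x := by ring
  rw [e]
  gcongr <;> exact bound (by assumption) x

lemma heatSol_rpow_mul_self {t : ℝ} (ht : 0 < t) (x : EuclideanSpace ℝ (Fin d)) {r s : ℝ}
    (h : s = r + 1) : heatSol μ t x ^ s = heatSol μ t x ^ r * heatSol μ t x := by
  rw [h, Real.rpow_add_one (heatSol_pos μ ht x).ne']

lemma integrable_heat_cubic {t q : ℝ} (ht : 0 < t) (hq : q ∈ Icc (1 : ℝ) 3)
    {f g h : EuclideanSpace ℝ (Fin d) → ℝ} (hf : IsHeatDerivative μ t f)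
    (hg : IsHeatDerivative μ t g) (hh : IsHeatDerivative μ t h) :
    Integrable fun x => heatSol μ t x ^ (q - 3) * (f x * g x * h x) := by
  refine (integrable_heat_quartic ht hq hf hg hh .sol).congr (ae_of_all _ fun x => ?_)
  simp only [heatSol_rpow_mul_self ht x (show q - 3 = q - 4 + 1 by ring)]
  ring

lemma integrable_heat_quadratic {t q : ℝ} (ht : 0 < t) (hq : q ∈ Icc (1 : ℝ) 3)
    {f g : EuclideanSpace ℝ (Fin d) → ℝ} (hf : IsHeatDerivative μ t f)
    (hg : IsHeatDerivative μ t g) :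
    Integrable fun x => heatSol μ t x ^ (q - 2) * (f x * g x) := by
  refine (integrable_heat_cubic ht hq hf hg .sol).congr (ae_of_all _ fun x => ?_)
  simp only [heatSol_rpow_mul_self ht x (show q - 2 = q - 3 + 1 by ring)]
  ring

lemma integrable_heat_linear {t q : ℝ} (ht : 0 < t) (hq : q ∈ Icc (1 : ℝ) 3)
    {f : EuclideanSpace ℝ (Fin d) → ℝ} (hf : IsHeatDerivative μ t f) :
    Integrable fun x => heatSol μ t x ^ (q - 1) * f x := by
  refine (integrable_heat_quadratic ht hq hf .sol).congr (ae_of_all _ fun x => ?_)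
  simp only [heatSol_rpow_mul_self ht x (show q - 1 = q - 2 + 1 by ring)]
  ring

lemma integrable_heatSol_rpow {t q : ℝ} (ht : 0 < t) (hq : q ∈ Icc (1 : ℝ) 3) :
    Integrable fun x => heatSol μ t x ^ q := by
  refine (integrable_heat_linear (μ := μ) ht hq .sol).congr (ae_of_all _ fun x => ?_)
  simp only [heatSol_rpow_mul_self ht x (show q = q - 1 + 1 by ring)]

/-- Integration by parts against the constant 1. Integrability of `f` and `f'` replaces any cutoff
or decay at infinity. -/
lemma integral_eq_zero_of_hasLineDerivAt {f f' : EuclideanSpace ℝ (Fin d) → ℝ}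
    {v : EuclideanSpace ℝ (Fin d)} (hf : Integrable f) (hf' : Integrable f')
    (h : ∀ x, HasLineDerivAt ℝ f (f' x) x v) : ∫ x, f' x = 0 := by
  have := integral_bilinear_hasLineDerivAt_right_eq_neg_left_of_integrable (μ := volume)
    (B := ContinuousLinearMap.mul ℝ ℝ) (f := fun _ : EuclideanSpace ℝ (Fin d) => (1 : ℝ))
    (f' := fun _ => 0) (g := f) (g' := f') (v := v) (by simp) (by simpa using hf')
    (by simpa using hf) (fun x _ => hasDerivAt_const _ _) (fun x _ => h x)
  simpa using this

lemma hasLineDerivAt_heatSol_rpow {t : ℝ} (ht : 0 < t) (r : ℝ) (i : Fin d)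
    (x : EuclideanSpace ℝ (Fin d)) :
    HasLineDerivAt ℝ (fun x => heatSol μ t x ^ r)
      (r * heatSol μ t x ^ (r - 1) * heatGrad μ i t x) x (EuclideanSpace.single i (1 : ℝ)) := by
  have h : HasDerivAt (fun s : ℝ => heatSol μ t (x + s • EuclideanSpace.single i (1 : ℝ)))
    (heatGrad μ i t x) 0 := hasLineDerivAt_heatSol μ i ht x
  have h2 := h.rpow_const (p := r) (Or.inl (heatSol_pos μ ht _).ne')
  simp only [zero_smul, add_zero] at h2
  exact h2.congr_deriv (by ring)

lemma HasLineDerivAt.mul_real {d : ℕ} {f g : EuclideanSpace ℝ (Fin d) → ℝ} {f' g' : ℝ}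
    {x v : EuclideanSpace ℝ (Fin d)} (hf : HasLineDerivAt ℝ f f' x v)
    (hg : HasLineDerivAt ℝ g g' x v) :
    HasLineDerivAt ℝ (fun x => f x * g x) (f' * g x + f x * g') x v := by
  have := HasDerivAt.fun_mul hf hg
  simpa [HasLineDerivAt] using this

/-- The divergence of `u ^ (q - 1) ∇u` integrates to zero. -/
lemma integral_div_rpow_grad {t q : ℝ} (ht : 0 < t) (hq : q ∈ Icc (1 : ℝ) 3) (i : Fin d) :
    ∫ x, ((q - 1) * (heatSol μ t x ^ (q - 2) * (heatGrad μ i t x * heatGrad μ i t x))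
      + heatSol μ t x ^ (q - 1) * heatHess μ i i t x) = 0 := by
  refine integral_eq_zero_of_hasLineDerivAt (v := EuclideanSpace.single i (1 : ℝ))
    (f := fun x => heatSol μ t x ^ (q - 1) * heatGrad μ i t x)
    (integrable_heat_linear ht hq (.grad i))
    (((integrable_heat_quadratic ht hq (.grad i) (.grad i)).const_mul _).add
      (integrable_heat_linear ht hq (.hess i i))) fun x => ?_
  have h := (hasLineDerivAt_heatSol_rpow (μ := μ) ht (q - 1) i x).mul_real
    (hasLineDerivAt_heatGrad μ i i ht x)
  rw [show q - 1 - 1 = q - 2 by ring] at h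
  convert! h using 1
  ring

end Integrability

/-! ### Time derivatives of ∫ u^q and of the Fisher information -/

section TimeDerivative

variable {d : ℕ} (μ : Measure (EuclideanSpace ℝ (Fin d)))

/-- The generalized Fisher information `∫ u ^ (q - 2) |∇u|²` of the heat flow. -/
def fisherInfo (q t : ℝ) : ℝ :=
  ∫ x, ∑ i, heatSol μ t x ^ (q - 2) * (heatGrad μ i t x * heatGrad μ i t x)

/-- The time derivative of the integrand of the generalized Fisher information. -/
def fisherRate (q t : ℝ) (x : EuclideanSpace ℝ (Fin d)) : ℝ :=
  ∑ i, ∑ j, ((q - 2) * (heatSol μ t x ^ (q - 3)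
      * (heatHess μ j j t x * heatGrad μ i t x * heatGrad μ i t x))
    + 2 * (heatSol μ t x ^ (q - 2) * (heatThird μ i j j t x * heatGrad μ i t x)))

variable [IsProbabilityMeasure μ]

lemma integrable_fisherInfo {t q : ℝ} (ht : 0 < t) (hq : q ∈ Icc (1 : ℝ) 3) :
    Integrable fun x => ∑ i, heatSol μ t x ^ (q - 2) * (heatGrad μ i t x * heatGrad μ i t x) :=
  integrable_finsetSum _ fun i _ => integrable_heat_quadratic ht hq (.grad i) (.grad i)

lemma integrable_fisherRate {t q : ℝ} (ht : 0 < t) (hq : q ∈ Icc (1 : ℝ) 3) :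
    Integrable (fisherRate μ q t) :=
  integrable_finsetSum _ fun i _ => integrable_finsetSum _ fun j _ =>
    ((integrable_heat_cubic ht hq (.hess j j) (.grad i) (.grad i)).const_mul _).add
      ((integrable_heat_quadratic ht hq (.third i j j) (.grad i)).const_mul _)

/-- The heat equation replaces ∂ₜu by Δu and ∂ₜ∂ᵢu by ∂ᵢΔu; the resulting terms are dominated by the
envelope on a compact time interval around `t`. -/
lemma hasDerivAt_fisherInfo {t q : ℝ} (ht : 0 < t) (hq : q ∈ Icc (1 : ℝ) 3) :
    HasDerivAt (fisherInfo μ q) (∫ x, fisherRate μ q t x) t := by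
  have hab : t / 2 ≤ 2 * t := by linarith
  obtain ⟨W, B, M, hB, hW⟩ := exists_envelope μ (half_pos ht) hab
  have hmem : Icc (t / 2) (2 * t) ∈ 𝓝 t := Icc_mem_nhds (by linarith) (by linarith)
  refine (hasDerivAt_integral_of_dominated_loc_of_deriv_le (μ := volume)
    (bound := fun x => d * (d * ((|q - 2| + 2) * B x))) hmem
    (F := fun t x => ∑ i, heatSol μ t x ^ (q - 2) * (heatGrad μ i t x * heatGrad μ i t x))
    (F' := fun t x => fisherRate μ q t x) ?_ (integrable_fisherInfo μ ht hq)
    (integrable_fisherRate μ ht hq).aestronglyMeasurable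
    (ae_of_all _ fun x s hs => ?_) (((hB.const_mul _).const_mul _).const_mul _)
    (ae_of_all _ fun x s hs => ?_)).2
  · filter_upwards [hmem] with s hs
    exact (integrable_fisherInfo μ (by linarith [hs.1]) hq).aestronglyMeasurable
  · have hs0 : 0 < s := by linarith [hs.1]
    obtain ⟨h0, -, h1, h2, h3, h4⟩ := hW s hs x
    have hu := heatSol_pos μ hs0 x
    have hWx : 0 ≤ W s x := hu.le.trans h0
    have key : ∀ i j, |(q - 2) * (heatSol μ s x ^ (q - 3)
        * (heatHess μ j j s x * heatGrad μ i s x * heatGrad μ i s x))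
        + 2 * (heatSol μ s x ^ (q - 2) * (heatThird μ i j j s x * heatGrad μ i s x))|
        ≤ (|q - 2| + 2) * B x := by
      intro i j
      rw [add_mul]
      refine (abs_add_le _ _).trans (add_le_add ?_ ?_)
      · rw [abs_mul, abs_mul, abs_of_pos (by positivity : 0 < heatSol μ s x ^ (q - 3)),
          abs_mul, abs_mul]
        gcongr
        refine le_trans ?_ ((rpow_sub_nat_mul_pow_le hu h0 q (by norm_num : 3 ≤ 4)).trans (h4 q hq))
        have e : W s x ^ 3 = W s x * W s x * W s x := by ring
        rw [e]
        push_cast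
        gcongr <;> first | apply h1 | apply h2
      · rw [abs_mul, abs_mul, abs_of_pos (by positivity : 0 < heatSol μ s x ^ (q - 2)), abs_mul,
          abs_two]
        gcongr
        refine le_trans ?_ ((rpow_sub_nat_mul_pow_le hu h0 q (by norm_num : 2 ≤ 4)).trans (h4 q hq))
        rw [pow_two]
        push_cast
        gcongr <;> first | apply h1 | apply h3
    have := abs_finsetSum_le_card_mul Finset.univ fun i =>
      abs_finsetSum_le_card_mul Finset.univ fun j => key i j
    simpa [fisherRate] using this
  · have hs0 : 0 < s := by linarith [hs.1]
    unfold fisherRate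
    refine HasDerivAt.fun_sum fun i _ => ?_
    have hg := hasDerivAt_heatGrad μ i hs0 x
    refine (((hasDerivAt_heatSol μ hs0 x).rpow_const (p := q - 2)
      (Or.inl (heatSol_pos μ hs0 x).ne')).mul (hg.mul hg)).congr_deriv ?_
    rw [Finset.sum_add_distrib, ← Finset.mul_sum, ← Finset.mul_sum, ← Finset.mul_sum,
      ← Finset.mul_sum, ← Finset.sum_mul, ← Finset.sum_mul, ← Finset.sum_mul,
      show q - 2 - 1 = q - 3 by ring]
    simp only [Pi.mul_apply]
    ring

/-- The derivative is q ∫ u^(q-1) Δu, and `integral_div_rpow_grad` moves one derivative. At q = 1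
this is conservation of mass. -/
lemma hasDerivAt_integral_heatSol_rpow {t q : ℝ} (ht : 0 < t) (hq : q ∈ Icc (1 : ℝ) 3) :
    HasDerivAt (fun t => ∫ x, heatSol μ t x ^ q) (-(q * (q - 1)) * fisherInfo μ q t) t := by
  have hab : t / 2 ≤ 2 * t := by linarith
  obtain ⟨W, B, M, hB, hW⟩ := exists_envelope μ (half_pos ht) hab
  have hmem : Icc (t / 2) (2 * t) ∈ 𝓝 t := Icc_mem_nhds (by linarith) (by linarith)
  have hint : Integrable fun x => q * ∑ j, heatSol μ t x ^ (q - 1) * heatHess μ j j t x :=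
    (integrable_finsetSum _ fun j _ => integrable_heat_linear ht hq (.hess j j)).const_mul _
  have h := (hasDerivAt_integral_of_dominated_loc_of_deriv_le (μ := volume)
    (bound := fun x => |q| * (d * B x)) hmem
    (F := fun t x => heatSol μ t x ^ q)
    (F' := fun t x => q * ∑ j, heatSol μ t x ^ (q - 1) * heatHess μ j j t x) ?_
    (integrable_heatSol_rpow ht hq) hint.aestronglyMeasurable
    (ae_of_all _ fun x s hs => ?_) ((hB.const_mul _).const_mul _)
    (ae_of_all _ fun x s hs => ?_)).2
  · refine h.congr_deriv ?_
    have e : ∀ j : Fin d, ∫ x, heatSol μ t x ^ (q - 1) * heatHess μ j j t x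
        = -(q - 1) * ∫ x, heatSol μ t x ^ (q - 2) * (heatGrad μ j t x * heatGrad μ j t x) := by
      intro j
      have := integral_div_rpow_grad (μ := μ) ht hq j
      rw [integral_add ((integrable_heat_quadratic ht hq (.grad j) (.grad j)).const_mul _)
        (integrable_heat_linear ht hq (.hess j j)), integral_const_mul] at this
      linarith
    rw [integral_const_mul, integral_finsetSum _
      fun j _ => integrable_heat_linear ht hq (.hess j j), fisherInfo, integral_finsetSum _
      fun j _ => integrable_heat_quadratic ht hq (.grad j) (.grad j)]
    simp only [e, ← Finset.mul_sum]
    ring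
  · filter_upwards [hmem] with s hs
    exact (integrable_heatSol_rpow (by linarith [hs.1]) hq).aestronglyMeasurable
  · have hs0 : 0 < s := by linarith [hs.1]
    obtain ⟨h0, -, h1, h2, h3, h4⟩ := hW s hs x
    have hu := heatSol_pos μ hs0 x
    have hWx : 0 ≤ W s x := hu.le.trans h0
    rw [Real.norm_eq_abs, abs_mul]
    gcongr
    have key : ∀ j, |heatSol μ s x ^ (q - 1) * heatHess μ j j s x| ≤ B x := by
      intro j
      rw [abs_mul, abs_of_pos (by positivity : 0 < heatSol μ s x ^ (q - 1))]
      refine le_trans ?_ ((rpow_sub_nat_mul_pow_le hu h0 q (by norm_num : 1 ≤ 4)).trans (h4 q hq))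
      rw [pow_one]
      push_cast
      gcongr
      exact h2 j j
    simpa using abs_finsetSum_le_card_mul Finset.univ key
  · have hs0 : 0 < s := by linarith [hs.1]
    refine ((hasDerivAt_heatSol μ hs0 x).rpow_const (p := q)
      (Or.inl (heatSol_pos μ hs0 x).ne')).congr_deriv ?_
    rw [← Finset.mul_sum]
    ring

/-- The Fisher information is bounded, locally uniformly in time and uniformly in `q`. -/
lemma exists_fisherInfo_bound {a b : ℝ} (ha : 0 < a) (hab : a ≤ b) :
    ∃ B : EuclideanSpace ℝ (Fin d) → ℝ, Integrable B ∧ ∀ t ∈ Icc a b, ∀ q ∈ Icc (1 : ℝ) 3, ∀ x,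
      ‖∑ i, heatSol μ t x ^ (q - 2) * (heatGrad μ i t x * heatGrad μ i t x)‖ ≤ B x := by
  obtain ⟨W, B, M, hB, hW⟩ := exists_envelope μ ha hab
  refine ⟨fun x => d * B x, hB.const_mul _, fun s hs q hq x => ?_⟩
  have hs0 : 0 < s := by linarith [hs.1]
  obtain ⟨h0, -, h1, h2, h3, h4⟩ := hW s hs x
  have hu := heatSol_pos μ hs0 x
  have hWx : 0 ≤ W s x := hu.le.trans h0
  have key : ∀ j, |heatSol μ s x ^ (q - 2) * (heatGrad μ j s x * heatGrad μ j s x)| ≤ B x := by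
    intro j
    rw [abs_mul, abs_of_pos (by positivity : 0 < heatSol μ s x ^ (q - 2)), abs_mul]
    refine le_trans ?_ ((rpow_sub_nat_mul_pow_le hu h0 q (by norm_num : 2 ≤ 4)).trans (h4 q hq))
    rw [pow_two]
    push_cast
    gcongr <;> exact h1 j
  simpa using abs_finsetSum_le_card_mul Finset.univ key

end TimeDerivative

/-! ### Positivity of the dissipation form -/

section QuadraticForm

variable {d : ℕ}

/-- The quadratic form in `v = 1 / u`, `g = ∇u`, `H = ∇²u`, that the time derivative of the Fisher
information yields after integrations by parts with weights `l + β = 2` and `γ`. -/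
def dissipationForm (p l β γ v : ℝ) (g : Fin d → ℝ) (H : Fin d → Fin d → ℝ) : ℝ :=
  ∑ i, ∑ j, (l * (H j j * H i i) + β * (H i j * H i j)
    + v * ((p * l - p) * (H j j * g i * g i) + (p * β + 2 * γ) * (H i j * g i * g j)
      + γ * (g j * g j * H i i)) + v ^ 2 * (γ * (p - 1) * (g i * g i * g j * g j)))

lemma dissipationForm_eq (p l β γ v : ℝ) (g : Fin d → ℝ) (H : Fin d → Fin d → ℝ) :
    dissipationForm p l β γ v g H = l * (∑ i, H i i) ^ 2 + β * ∑ i, ∑ j, H i j * H i j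
      + v * ((p * l - p + γ) * ((∑ i, H i i) * ∑ i, g i * g i)
        + (p * β + 2 * γ) * ∑ i, ∑ j, H i j * g i * g j)
      + v ^ 2 * (γ * (p - 1) * (∑ i, g i * g i) ^ 2) := by
  have h1 : ∑ i, ∑ j, H j j * H i i = (∑ i, H i i) ^ 2 := by
    rw [pow_two, Finset.sum_mul_sum]
    exact Finset.sum_congr rfl fun i _ => Finset.sum_congr rfl fun j _ => mul_comm _ _
  have h2 : ∑ i, ∑ j, H j j * g i * g i = (∑ i, H i i) * ∑ i, g i * g i := by
    rw [mul_comm, Finset.sum_mul_sum]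
    exact Finset.sum_congr rfl fun i _ => Finset.sum_congr rfl fun j _ => by ring
  have h3 : ∑ i, ∑ j, g j * g j * H i i = (∑ i, H i i) * ∑ i, g i * g i := by
    rw [Finset.sum_mul_sum]
    exact Finset.sum_congr rfl fun i _ => Finset.sum_congr rfl fun j _ => by ring
  have h4 : ∑ i, ∑ j, g i * g i * g j * g j = (∑ i, g i * g i) ^ 2 := by
    rw [pow_two, Finset.sum_mul_sum]
    exact Finset.sum_congr rfl fun i _ => Finset.sum_congr rfl fun j _ => by ring
  simp only [dissipationForm, Finset.sum_add_distrib, ← Finset.mul_sum, h1, h2, h3, h4]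
  ring

/-- The expression is the squared Frobenius norm of H + c g⊗g. -/
lemma hess_add_outer_sq_nonneg (c : ℝ) (g : Fin d → ℝ) (H : Fin d → Fin d → ℝ) :
    0 ≤ ∑ i, ∑ j, H i j * H i j + 2 * c * ∑ i, ∑ j, H i j * g i * g j
      + c ^ 2 * (∑ i, g i * g i) ^ 2 := by
  have h4 : (∑ i, g i * g i) ^ 2 = ∑ i, ∑ j, g i * g i * (g j * g j) := by
    rw [pow_two, Finset.sum_mul_sum]
  have : ∑ i, ∑ j, H i j * H i j + 2 * c * ∑ i, ∑ j, H i j * g i * g j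
      + c ^ 2 * (∑ i, g i * g i) ^ 2 = ∑ i, ∑ j, (H i j + c * (g i * g j)) ^ 2 := by
    rw [h4]
    simp only [Finset.mul_sum, ← Finset.sum_add_distrib]
    exact Finset.sum_congr rfl fun i _ => Finset.sum_congr rfl fun j _ => by ring
  rw [this]
  positivity

/-- With γ = p the terms in tr H vanish, and the form is 2|H + pv g⊗g|² - p(1+p)(v|g|²)². -/
lemma dissipationForm_nonneg_of_nonpos {p : ℝ} (hp1 : -1 ≤ p) (hp0 : p ≤ 0) (v : ℝ)
    (g : Fin d → ℝ) (H : Fin d → Fin d → ℝ) : 0 ≤ dissipationForm p 0 2 p v g H := by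
  rw [dissipationForm_eq]
  have h := hess_add_outer_sq_nonneg (p * v) g H
  have h2 : 0 ≤ -p * (1 + p) * (v * ∑ i, g i * g i) ^ 2 :=
    mul_nonneg (mul_nonneg (by linarith) (by linarith)) (sq_nonneg _)
  linarith

/-- For l = β = 1, completing the squares in tr H and in H leaves (-γ - 5γ²/4 - p²/4)(v|g|²)². The
choice γ = -2/5 maximizes this coefficient, with value 1/5 - p²/4. -/
lemma dissipationForm_nonneg_of_sq_le {p : ℝ} (hp : p ^ 2 ≤ 4 / 5) (v : ℝ)
    (g : Fin d → ℝ) (H : Fin d → Fin d → ℝ) :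
    0 ≤ dissipationForm p 1 1 (-(2 / 5)) v g H := by
  rw [dissipationForm_eq]
  have h := hess_add_outer_sq_nonneg ((p / 2 - 2 / 5) * v) g H
  have h1 : 0 ≤ (∑ i, H i i - 1 / 5 * v * ∑ i, g i * g i) ^ 2 := sq_nonneg _
  have h2 : 0 ≤ (1 / 5 - p ^ 2 / 4) * (v * ∑ i, g i * g i) ^ 2 :=
    mul_nonneg (by linarith) (sq_nonneg _)
  linarith

/-- In dimension one the cross term has coefficient p + 3γ; γ = -p/3 removes it and leaves 2H² +
(p(1-p)/3)(v g²)². -/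
lemma dissipationForm_nonneg_of_dim_one {p : ℝ} (hp0 : 0 ≤ p) (hp1 : p ≤ 1) (v : ℝ)
    (g : Fin 1 → ℝ) (H : Fin 1 → Fin 1 → ℝ) :
    0 ≤ dissipationForm p 2 0 (-p / 3) v g H := by
  rw [dissipationForm_eq]
  simp only [Fin.sum_univ_one]
  have h1 : 0 ≤ p * (1 - p) * (v * (g 0 * g 0)) ^ 2 :=
    mul_nonneg (mul_nonneg hp0 (by linarith)) (sq_nonneg _)
  have h2 := sq_nonneg (H 0 0)
  linarith

lemma exists_dissipationForm_nonneg {q : ℝ}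
    (hq : (d = 1 ∧ q ∈ Icc (1 : ℝ) 3) ∨
      (1 < d ∧ q ∈ Icc (1 : ℝ) (2 * (Real.sqrt 5 + 1) / Real.sqrt 5))) :
    ∃ l β γ : ℝ, l + β = 2 ∧ ∀ (v : ℝ) (g : Fin d → ℝ) (H : Fin d → Fin d → ℝ),
      0 ≤ dissipationForm (q - 2) l β γ v g H := by
  have hq1 : 1 ≤ q := by rcases hq with h | h <;> exact h.2.1
  rcases le_total q 2 with h2 | h2
  · exact ⟨0, 2, q - 2, by norm_num, dissipationForm_nonneg_of_nonpos (by linarith) (by linarith)⟩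
  rcases hq with ⟨rfl, hq⟩ | ⟨-, hq⟩
  · exact ⟨2, 0, -(q - 2) / 3, by norm_num,
      dissipationForm_nonneg_of_dim_one (by linarith) (by linarith [hq.2])⟩
  · refine ⟨1, 1, -(2 / 5), by norm_num, dissipationForm_nonneg_of_sq_le ?_⟩
    have h5 : 0 < Real.sqrt 5 := by positivity
    have h5' : Real.sqrt 5 ^ 2 = 5 := Real.sq_sqrt (by norm_num)
    -- The upper endpoint for d > 1 is precisely where (q-2)² = 4/5.
    have e : 2 * (Real.sqrt 5 + 1) / Real.sqrt 5 - 2 = 2 / Real.sqrt 5 := by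
      field_simp
      ring
    have hle : q - 2 ≤ 2 / Real.sqrt 5 := by linarith [hq.2]
    calc (q - 2) ^ 2 ≤ (2 / Real.sqrt 5) ^ 2 := by
          gcongr
      _ = 4 / 5 := by rw [div_pow, h5']; norm_num

lemma mem_Icc_of_exponent_range {q : ℝ}
    (hq : (d = 1 ∧ q ∈ Icc (1 : ℝ) 3) ∨
      (1 < d ∧ q ∈ Icc (1 : ℝ) (2 * (Real.sqrt 5 + 1) / Real.sqrt 5))) : q ∈ Icc (1 : ℝ) 3 := by
  rcases hq with ⟨-, h⟩ | ⟨-, h⟩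
  · exact h
  · refine ⟨h.1, h.2.trans ?_⟩
    have h5 : 0 < Real.sqrt 5 := by positivity
    rw [div_le_iff₀ h5]
    have : 2 ≤ Real.sqrt 5 := Real.le_sqrt_of_sq_le (by norm_num)
    linarith

end QuadraticForm

/-! ### Monotonicity of the Fisher information -/

section Dissipation

variable {d : ℕ} (μ : Measure (EuclideanSpace ℝ (Fin d)))

/-- The `i`-th partial derivative of `u ^ (q - 2) ∂ⱼ∂ₖu ∂ₙu`. -/
def hessGradDiv (q t : ℝ) (i j k n : Fin d) (x : EuclideanSpace ℝ (Fin d)) : ℝ :=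
  (q - 2) * (heatSol μ t x ^ (q - 3)
      * (heatGrad μ i t x * heatHess μ j k t x * heatGrad μ n t x))
    + heatSol μ t x ^ (q - 2) * (heatThird μ j k i t x * heatGrad μ n t x)
    + heatSol μ t x ^ (q - 2) * (heatHess μ j k t x * heatHess μ n i t x)

/-- The `i`-th partial derivative of `u ^ (q - 3) (∂ⱼu)² ∂ᵢu`. -/
def gradCubedDiv (q t : ℝ) (i j : Fin d) (x : EuclideanSpace ℝ (Fin d)) : ℝ :=
  (q - 3) * (heatSol μ t x ^ (q - 4)
      * (heatGrad μ i t x * heatGrad μ i t x * heatGrad μ j t x * heatGrad μ j t x))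
    + 2 * (heatSol μ t x ^ (q - 3)
      * (heatHess μ j i t x * heatGrad μ j t x * heatGrad μ i t x))
    + heatSol μ t x ^ (q - 3)
      * (heatGrad μ j t x * heatGrad μ j t x * heatHess μ i i t x)

variable [IsProbabilityMeasure μ]

lemma integrable_hessGradDiv {t q : ℝ} (ht : 0 < t) (hq : q ∈ Icc (1 : ℝ) 3) (i j k n : Fin d) :
    Integrable (hessGradDiv μ q t i j k n) :=
  (((integrable_heat_cubic ht hq (.grad i) (.hess j k) (.grad n)).const_mul _).add
    (integrable_heat_quadratic ht hq (.third j k i) (.grad n))).add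
    (integrable_heat_quadratic ht hq (.hess j k) (.hess n i))

lemma integrable_gradCubedDiv {t q : ℝ} (ht : 0 < t) (hq : q ∈ Icc (1 : ℝ) 3) (i j : Fin d) :
    Integrable (gradCubedDiv μ q t i j) :=
  (((integrable_heat_quartic ht hq (.grad i) (.grad i) (.grad j) (.grad j)).const_mul _).add
    ((integrable_heat_cubic ht hq (.hess j i) (.grad j) (.grad i)).const_mul _)).add
    (integrable_heat_cubic ht hq (.grad j) (.grad j) (.hess i i))

lemma integral_hessGradDiv {t q : ℝ} (ht : 0 < t) (hq : q ∈ Icc (1 : ℝ) 3) (i j k n : Fin d) :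
    ∫ x, hessGradDiv μ q t i j k n x = 0 := by
  refine integral_eq_zero_of_hasLineDerivAt (v := EuclideanSpace.single i (1 : ℝ))
    (f := fun x => heatSol μ t x ^ (q - 2) * (heatHess μ j k t x * heatGrad μ n t x))
    (integrable_heat_quadratic ht hq (.hess j k) (.grad n))
    (integrable_hessGradDiv μ ht hq i j k n) fun x => ?_
  have h := (hasLineDerivAt_heatSol_rpow (μ := μ) ht (q - 2) i x).mul_real
    ((hasLineDerivAt_heatHess μ j k i ht x).mul_real (hasLineDerivAt_heatGrad μ n i ht x))
  rw [show q - 2 - 1 = q - 3 by ring] at h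
  convert! h using 1
  rw [hessGradDiv]
  ring

lemma integral_gradCubedDiv {t q : ℝ} (ht : 0 < t) (hq : q ∈ Icc (1 : ℝ) 3) (i j : Fin d) :
    ∫ x, gradCubedDiv μ q t i j x = 0 := by
  refine integral_eq_zero_of_hasLineDerivAt (v := EuclideanSpace.single i (1 : ℝ))
    (f := fun x => heatSol μ t x ^ (q - 3)
      * (heatGrad μ j t x * heatGrad μ j t x * heatGrad μ i t x))
    (integrable_heat_cubic ht hq (.grad j) (.grad j) (.grad i))
    (integrable_gradCubedDiv μ ht hq i j) fun x => ?_
  have h := (hasLineDerivAt_heatSol_rpow (μ := μ) ht (q - 3) i x).mul_real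
    (((hasLineDerivAt_heatGrad μ j i ht x).mul_real (hasLineDerivAt_heatGrad μ j i ht x)).mul_real
      (hasLineDerivAt_heatGrad μ i i ht x))
  rw [show q - 3 - 1 = q - 4 by ring] at h
  convert! h using 1
  rw [gradCubedDiv]
  ring

/-- The divergences of u^(q-2) Δu ∇u and u^(q-2) ∇²u ∇u both contain u^(q-2) ∇u·∇Δu, with total
weight l + β = 2, so the third derivatives in `fisherRate` cancel pointwise. -/
lemma rpow_mul_dissipationForm_eq {t : ℝ} (q : ℝ) (ht : 0 < t) {l β : ℝ} (γ : ℝ)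
    (hlβ : l + β = 2) (x : EuclideanSpace ℝ (Fin d)) :
    heatSol μ t x ^ (q - 2) * dissipationForm (q - 2) l β γ
      (heatSol μ t x)⁻¹ (fun i => heatGrad μ i t x) (fun i j => heatHess μ i j t x)
      = ∑ i, ∑ j, (l * hessGradDiv μ q t i j j i x + β * hessGradDiv μ q t i i j j x
        + γ * gradCubedDiv μ q t i j x) - fisherRate μ q t x := by
  have hu := heatSol_pos μ ht x
  have e3 : heatSol μ t x ^ (q - 3) = heatSol μ t x ^ (q - 2) * (heatSol μ t x)⁻¹ := by
    rw [show q - 3 = q - 2 - 1 by ring, Real.rpow_sub_one hu.ne', div_eq_mul_inv]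
  have e4 : heatSol μ t x ^ (q - 4)
      = heatSol μ t x ^ (q - 2) * (heatSol μ t x)⁻¹ * (heatSol μ t x)⁻¹ := by
    rw [show q - 4 = q - 3 - 1 by ring, Real.rpow_sub_one hu.ne', div_eq_mul_inv, e3]
  -- Exchanging the summation indices lets ∇u·∇Δu be written in the form matching either divergence.
  have hswap : ∑ i, ∑ j, heatThird μ i j i t x * heatGrad μ j t x
      = ∑ i, ∑ j, heatThird μ i j j t x * heatGrad μ i t x := by
    rw [Finset.sum_comm]
    refine Finset.sum_congr rfl fun i _ => Finset.sum_congr rfl fun j _ => ?_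
    rw [heatThird_comm_left]
  have hrate : fisherRate μ q t x = ∑ i, ∑ j, (((q - 2) * (heatSol μ t x ^ (q - 3)
      * (heatHess μ j j t x * heatGrad μ i t x * heatGrad μ i t x))
      + l * (heatSol μ t x ^ (q - 2) * (heatThird μ i j j t x * heatGrad μ i t x)))
      + β * (heatSol μ t x ^ (q - 2) * (heatThird μ i j i t x * heatGrad μ j t x))) := by
    obtain rfl : β = 2 - l := by linarith
    simp only [fisherRate, Finset.sum_add_distrib, ← Finset.mul_sum, hswap]
    ring
  rw [hrate, dissipationForm, Finset.mul_sum, ← Finset.sum_sub_distrib]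
  refine Finset.sum_congr rfl fun i _ => ?_
  rw [Finset.mul_sum, ← Finset.sum_sub_distrib]
  refine Finset.sum_congr rfl fun j _ => ?_
  rw [hessGradDiv, hessGradDiv, gradCubedDiv, heatThird_comm_right μ j j i,
    heatThird_comm_left μ j i j, heatHess_comm μ j i, e3, e4]
  ring

/-- The Fisher information dissipates as the integral of `u ^ (q - 2)` times the quadratic form. -/
lemma integral_fisherRate {t q : ℝ} (ht : 0 < t) (hq : q ∈ Icc (1 : ℝ) 3) {l β : ℝ} (γ : ℝ)
    (hlβ : l + β = 2) :
    ∫ x, fisherRate μ q t x = -∫ x, heatSol μ t x ^ (q - 2) * dissipationForm (q - 2) l β γ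
      (heatSol μ t x)⁻¹ (fun i => heatGrad μ i t x) fun i j => heatHess μ i j t x := by
  have h1 := fun i j : Fin d => (integrable_hessGradDiv μ ht hq i j j i).const_mul l
  have h2 := fun i j : Fin d => (integrable_hessGradDiv μ ht hq i i j j).const_mul β
  have h3 := fun i j : Fin d => (integrable_gradCubedDiv μ ht hq i j).const_mul γ
  have h12 : ∀ i j : Fin d, Integrable fun x => l * hessGradDiv μ q t i j j i x
      + β * hessGradDiv μ q t i i j j x := fun i j => (h1 i j).add (h2 i j)
  have hD : ∀ i j : Fin d, Integrable fun x => l * hessGradDiv μ q t i j j i x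
      + β * hessGradDiv μ q t i i j j x + γ * gradCubedDiv μ q t i j x := fun i j =>
    (h12 i j).add (h3 i j)
  have hzero : ∫ x, ∑ i, ∑ j, (l * hessGradDiv μ q t i j j i x
      + β * hessGradDiv μ q t i i j j x + γ * gradCubedDiv μ q t i j x) = 0 := by
    rw [integral_finsetSum _ fun i _ => integrable_finsetSum _ fun j _ => hD i j]
    refine Finset.sum_eq_zero fun i _ => ?_
    rw [integral_finsetSum _ fun j _ => hD i j]
    refine Finset.sum_eq_zero fun j _ => ?_
    rw [integral_add (h12 i j) (h3 i j), integral_add (h1 i j) (h2 i j)]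
    simp only [integral_const_mul, integral_hessGradDiv μ ht hq, integral_gradCubedDiv μ ht hq,
      mul_zero, add_zero]
  simp only [rpow_mul_dissipationForm_eq μ q ht γ hlβ]
  rw [integral_sub (integrable_finsetSum _ fun i _ => integrable_finsetSum _ fun j _ => hD i j)
    (integrable_fisherRate μ ht hq), hzero]
  ring

lemma integral_fisherRate_nonpos {t q : ℝ} (ht : 0 < t)
    (hq : (d = 1 ∧ q ∈ Icc (1 : ℝ) 3) ∨
      (1 < d ∧ q ∈ Icc (1 : ℝ) (2 * (Real.sqrt 5 + 1) / Real.sqrt 5))) :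
    ∫ x, fisherRate μ q t x ≤ 0 := by
  obtain ⟨l, β, γ, hlβ, hpos⟩ := exists_dissipationForm_nonneg hq
  rw [integral_fisherRate μ ht (mem_Icc_of_exponent_range hq) γ hlβ, neg_nonpos]
  refine integral_nonneg fun x => mul_nonneg ?_ (hpos _ _ _)
  exact Real.rpow_nonneg (heatSol_pos μ ht x).le _

end Dissipation

/-! ### Approximation of the logarithm by powers -/

section DeformedLog

/-- The deformed logarithm `(x ^ h - 1) / h`, which tends to `log x` as `h → 0`. -/
def deformedLog (h x : ℝ) : ℝ := h⁻¹ * (x ^ h - 1)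

lemma log_le_deformedLog {h x : ℝ} (hh : 0 < h) (hx : 0 < x) : Real.log x ≤ deformedLog h x := by
  unfold deformedLog
  rw [inv_mul_eq_div, le_div_iff₀ hh, Real.rpow_def_of_pos hx]
  linarith [Real.add_one_le_exp (Real.log x * h)]

/-- Bernoulli's inequality for exponents in [0, 1]. The bound is uniform in h, as Fatou and
dominated convergence require. -/
lemma deformedLog_le {h x : ℝ} (hh : 0 < h) (hh1 : h ≤ 1) (hx : 0 < x) :
    deformedLog h x ≤ x - 1 := by
  unfold deformedLog
  rw [inv_mul_eq_div, div_le_iff₀ hh]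
  have := rpow_one_add_le_one_add_mul_self (s := x - 1) (by linarith) hh.le hh1
  rw [show 1 + (x - 1) = x by ring] at this
  linarith

/-- A sequence in `(0, 1]` tending to zero. -/
def smallExponent (n : ℕ) : ℝ := 1 / ((n : ℝ) + 1)

lemma smallExponent_pos (n : ℕ) : 0 < smallExponent n := Nat.one_div_pos_of_nat

lemma smallExponent_le_one (n : ℕ) : smallExponent n ≤ 1 := by
  rw [smallExponent, div_le_one (by positivity)]
  have : (0 : ℝ) ≤ n := by positivity
  linarith

lemma tendsto_smallExponent : Tendsto smallExponent atTop (𝓝 0) :=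
  tendsto_one_div_add_atTop_nhds_zero_nat

lemma tendsto_deformedLog {x : ℝ} (hx : 0 < x) :
    Tendsto (fun n => deformedLog (smallExponent n) x) atTop (𝓝 (Real.log x)) :=
  (tendsto_rpow_sub_one_log hx).comp
    (tendsto_nhdsWithin_iff.2 ⟨tendsto_smallExponent, Eventually.of_forall smallExponent_pos⟩)

end DeformedLog

/-! ### The Shannon case q = 1 -/

section Shannon

variable {d : ℕ} (μ : Measure (EuclideanSpace ℝ (Fin d))) [IsProbabilityMeasure μ]

/-- The approximations `-∫ u (u ^ h - 1) / h` of the Shannon entropy of the heat flow. -/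
def deformedEntropy (h t : ℝ) : ℝ := -∫ x, heatSol μ t x * deformedLog h (heatSol μ t x)

lemma heatSol_mul_deformedLog (h : ℝ) {t : ℝ} (ht : 0 < t) (x : EuclideanSpace ℝ (Fin d)) :
    heatSol μ t x * deformedLog h (heatSol μ t x)
      = h⁻¹ * (heatSol μ t x ^ (1 + h) - heatSol μ t x ^ (1 : ℝ)) := by
  rw [deformedLog, Real.rpow_add (heatSol_pos μ ht x), Real.rpow_one]
  ring

lemma integrable_heatSol {t : ℝ} (ht : 0 < t) : Integrable (heatSol μ t) := by
  simpa using integrable_heatSol_rpow (μ := μ) (q := 1) ht ⟨le_rfl, by norm_num⟩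

lemma integrable_heatSol_mul_deformedLog {h t : ℝ} (hh : 0 < h) (hh1 : h ≤ 1) (ht : 0 < t) :
    Integrable fun x => heatSol μ t x * deformedLog h (heatSol μ t x) := by
  simp only [heatSol_mul_deformedLog μ h ht]
  exact ((integrable_heatSol_rpow ht ⟨by linarith, by linarith⟩).sub
    (integrable_heatSol_rpow ht ⟨le_rfl, by norm_num⟩)).const_mul _

lemma hasDerivAt_deformedEntropy {h t : ℝ} (hh : 0 < h) (hh1 : h ≤ 1) (ht : 0 < t) :
    HasDerivAt (deformedEntropy μ h) ((1 + h) * fisherInfo μ (1 + h) t) t := by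
  have h1 : (1 + h) ∈ Icc (1 : ℝ) 3 := ⟨by linarith, by linarith⟩
  have h0 : (1 : ℝ) ∈ Icc (1 : ℝ) 3 := ⟨le_rfl, by norm_num⟩
  -- The second integral is the mass: its derivative carries the factor q - 1 = 0.
  have hd := (((hasDerivAt_integral_heatSol_rpow μ ht h1).sub
    (hasDerivAt_integral_heatSol_rpow μ ht h0)).const_mul h⁻¹).neg
  have hd' : HasDerivAt (fun t => -(h⁻¹ * ((∫ x, heatSol μ t x ^ (1 + h))
      - ∫ x, heatSol μ t x ^ (1 : ℝ)))) ((1 + h) * fisherInfo μ (1 + h) t) t := by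
    refine hd.congr_deriv ?_
    field_simp
    ring
  refine hd'.congr_of_eventuallyEq ?_
  filter_upwards [Ioi_mem_nhds ht] with s hs
  rw [deformedEntropy]
  simp only [heatSol_mul_deformedLog μ h hs]
  rw [integral_const_mul, integral_sub (integrable_heatSol_rpow hs h1)
    (integrable_heatSol_rpow hs h0)]

lemma continuousOn_fisherInfo {q : ℝ} (hq : q ∈ Icc (1 : ℝ) 3) :
    ContinuousOn (fisherInfo μ q) (Ioi 0) := fun _ ht =>
  (hasDerivAt_fisherInfo μ ht hq).continuousAt.continuousWithinAt

lemma uIcc_subset_Ioi_zero {s t : ℝ} (hs : 0 < s) (ht : 0 < t) : uIcc s t ⊆ Ioi (0 : ℝ) :=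
  fun _ hx => (lt_min hs ht).trans_le hx.1

lemma integral_fisherInfo_eq_sub {h s t : ℝ} (hh : 0 < h) (hh1 : h ≤ 1) (hs : 0 < s)
    (ht : 0 < t) :
    ∫ τ in s..t, (1 + h) * fisherInfo μ (1 + h) τ
      = deformedEntropy μ h t - deformedEntropy μ h s := by
  have hsub := uIcc_subset_Ioi_zero hs ht
  refine intervalIntegral.integral_eq_sub_of_hasDerivAt
    (fun x hx => hasDerivAt_deformedEntropy μ hh hh1 (hsub hx)) ?_
  exact (continuousOn_const.mul
    ((continuousOn_fisherInfo μ ⟨by linarith, by linarith⟩).mono hsub)).intervalIntegrable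

lemma tendsto_integral_fisherInfo {s t : ℝ} (hs : 0 < s) (ht : 0 < t) :
    Tendsto (fun n => ∫ τ in s..t, (1 + smallExponent n) * fisherInfo μ (1 + smallExponent n) τ)
      atTop (𝓝 (∫ τ in s..t, fisherInfo μ 1 τ)) := by
  obtain ⟨B, hB, hBd⟩ := exists_fisherInfo_bound μ (lt_min hs ht) (min_le_max (a := s) (b := t))
  have hsub := uIcc_subset_Ioi_zero hs ht
  have hmem : ∀ n, 1 + smallExponent n ∈ Icc (1 : ℝ) 3 := fun n =>
    ⟨by linarith [smallExponent_pos n], by linarith [smallExponent_le_one n]⟩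
  have hlim : Tendsto (fun n => 1 + smallExponent n) atTop (𝓝 1) := by
    simpa using tendsto_smallExponent.const_add 1
  refine intervalIntegral.tendsto_integral_filter_of_dominated_convergence
    (fun _ => 2 * ∫ x, B x) (Eventually.of_forall fun n => ?_)
    (Eventually.of_forall fun n => ae_of_all _ fun τ hτ => ?_) intervalIntegrable_const
    (ae_of_all _ fun τ hτ => ?_)
  · exact ((continuousOn_const.mul ((continuousOn_fisherInfo μ (hmem n)).mono
      (uIoc_subset_uIcc.trans hsub)))).aestronglyMeasurable measurableSet_uIoc
  · rw [Real.norm_eq_abs, abs_mul, abs_of_pos (by linarith [smallExponent_pos n])]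
    have h1 : 1 + smallExponent n ≤ 2 := by linarith [smallExponent_le_one n]
    have h2 : |fisherInfo μ (1 + smallExponent n) τ| ≤ ∫ x, B x :=
      norm_integral_le_of_norm_le hB
        (ae_of_all _ (hBd τ (uIoc_subset_uIcc hτ) _ (hmem n)))
    gcongr
  · have hτ0 : 0 < τ := hsub (uIoc_subset_uIcc hτ)
    have h1 : Tendsto (fun n => fisherInfo μ (1 + smallExponent n) τ) atTop
        (𝓝 (fisherInfo μ 1 τ)) := by
      refine tendsto_integral_filter_of_dominated_convergence B
        (Eventually.of_forall fun n => (integrable_fisherInfo μ hτ0 (hmem n)).aestronglyMeasurable)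
        (Eventually.of_forall fun n => ae_of_all _ (hBd τ (uIoc_subset_uIcc hτ) _ (hmem n))) hB
        (ae_of_all _ fun x => tendsto_finsetSum _ fun i _ => Tendsto.mul_const _ ?_)
      exact (Real.continuous_const_rpow (heatSol_pos μ hτ0 x).ne').continuousAt.tendsto.comp
        (hlim.sub_const 2)
    simpa using hlim.mul h1

lemma exists_heatSol_le {t : ℝ} (ht : 0 < t) : ∃ M : ℝ, 0 < M ∧ ∀ x, heatSol μ t x ≤ M := by
  obtain ⟨W, B, M, -, hW⟩ := exists_envelope μ ht le_rfl
  have hM : ∀ x, heatSol μ t x ≤ M := fun x => (hW t ⟨le_rfl, le_rfl⟩ x).2.1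
  exact ⟨M, (heatSol_pos μ ht 0).trans_le (hM 0), hM⟩

lemma continuous_heatSol_mul_log {t : ℝ} (ht : 0 < t) :
    Continuous fun x => heatSol μ t x * Real.log (heatSol μ t x) :=
  (continuous_heatSol μ ht).mul
    ((continuous_heatSol μ ht).log fun x => (heatSol_pos μ ht x).ne')

lemma deformedEntropy_le {s : ℝ} (hs : 0 < s)
    (hi : Integrable fun x => heatSol μ s x * Real.log (heatSol μ s x)) (n : ℕ) :
    deformedEntropy μ (smallExponent n) s
      ≤ -∫ x, heatSol μ s x * Real.log (heatSol μ s x) := by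
  refine neg_le_neg (integral_mono hi (integrable_heatSol_mul_deformedLog μ (smallExponent_pos n)
    (smallExponent_le_one n) hs) fun x => ?_)
  exact mul_le_mul_of_nonneg_left (log_le_deformedLog (smallExponent_pos n) (heatSol_pos μ hs x))
    (heatSol_pos μ hs x).le

/-- Finiteness of the Shannon entropy does not depend on time. -/
lemma integrable_mul_log_of_integrable {s t : ℝ} (hs : 0 < s) (ht : 0 < t)
    (hi : Integrable fun x => heatSol μ s x * Real.log (heatSol μ s x)) :
    Integrable fun x => heatSol μ t x * Real.log (heatSol μ t x) := by
  obtain ⟨M, hM0, hM⟩ := exists_heatSol_le μ ht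
  obtain ⟨K, hK⟩ := (tendsto_integral_fisherInfo μ hs ht).bddAbove_range
  have hu := integrable_heatSol μ ht
  have hf : ∀ n, Integrable fun x => M * heatSol μ t x
      - heatSol μ t x * deformedLog (smallExponent n) (heatSol μ t x) := fun n =>
    (hu.const_mul M).sub
      (integrable_heatSol_mul_deformedLog μ (smallExponent_pos n) (smallExponent_le_one n) ht)
  -- Adding Mu makes the approximating integrands nonnegative, as Fatou's lemma needs.
  have hf0 : ∀ n x, 0 ≤ M * heatSol μ t x
      - heatSol μ t x * deformedLog (smallExponent n) (heatSol μ t x) := by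
    intro n x
    have h0 := heatSol_pos μ ht x
    have h1 := deformedLog_le (smallExponent_pos n) (smallExponent_le_one n) h0
    have h2 : deformedLog (smallExponent n) (heatSol μ t x) ≤ M := by linarith [hM x]
    nlinarith
  -- The deformed entropy at `t` is that at `s`, at most the finite Shannon entropy, plus a time
  -- integral bounded by K. Oriented integrals cover both orders of `s` and `t`.
  have hbound : ∀ n, ∫ x, (M * heatSol μ t x
      - heatSol μ t x * deformedLog (smallExponent n) (heatSol μ t x))
      ≤ M * (∫ x, heatSol μ t x) + (K - ∫ x, heatSol μ s x * Real.log (heatSol μ s x)) := by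
    intro n
    rw [integral_sub (hu.const_mul M) (integrable_heatSol_mul_deformedLog μ (smallExponent_pos n)
      (smallExponent_le_one n) ht), integral_const_mul]
    have h1 := integral_fisherInfo_eq_sub μ (smallExponent_pos n) (smallExponent_le_one n) hs ht
    have h2 := hK ⟨n, rfl⟩
    have h3 := deformedEntropy_le μ hs hi n
    simp only [deformedEntropy] at h1 h2 h3
    linarith
  have hlim : ∀ x, Tendsto (fun n => M * heatSol μ t x
      - heatSol μ t x * deformedLog (smallExponent n) (heatSol μ t x)) atTop
      (𝓝 (M * heatSol μ t x - heatSol μ t x * Real.log (heatSol μ t x))) := fun x =>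
    ((tendsto_deformedLog (heatSol_pos μ ht x)).const_mul _).const_sub _
  have hfin : Integrable fun x => M * heatSol μ t x
      - heatSol μ t x * Real.log (heatSol μ t x) := by
    refine ⟨((continuous_const.mul (continuous_heatSol μ ht)).sub
      (continuous_heatSol_mul_log μ ht)).aestronglyMeasurable, ?_⟩
    -- Fatou's lemma along `smallExponent`.
    refine lt_of_le_of_lt ((lintegral_congr fun x => (hlim x).enorm.liminf_eq.symm).trans_le
      (lintegral_liminf_le' fun n => (hf n).aestronglyMeasurable.enorm)) ?_
    refine lt_of_le_of_lt (liminf_le_of_le (by isBoundedDefault)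
      (a := ENNReal.ofReal (M * (∫ x, heatSol μ t x)
        + (K - ∫ x, heatSol μ s x * Real.log (heatSol μ s x)))) fun b hb => ?_)
      ENNReal.ofReal_lt_top
    obtain ⟨n, hn⟩ := hb.exists
    refine hn.trans ?_
    rw [← ofReal_integral_norm_eq_lintegral_enorm (hf n)]
    refine ENNReal.ofReal_le_ofReal (le_trans (le_of_eq ?_) (hbound n))
    exact integral_congr_ae (ae_of_all _ fun x => Real.norm_of_nonneg (hf0 n x))
  exact ((hu.const_mul M).sub hfin).congr (ae_of_all _ fun x => sub_sub_cancel _ _)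

/-- Dominated convergence: the integrands lie between u log u and Mu. -/
lemma tendsto_deformedEntropy {t : ℝ} (ht : 0 < t)
    (hi : Integrable fun x => heatSol μ t x * Real.log (heatSol μ t x)) :
    Tendsto (fun n => deformedEntropy μ (smallExponent n) t) atTop
      (𝓝 (-∫ x, heatSol μ t x * Real.log (heatSol μ t x))) := by
  obtain ⟨M, hM0, hM⟩ := exists_heatSol_le μ ht
  refine (tendsto_integral_filter_of_dominated_convergence
    (fun x => |heatSol μ t x * Real.log (heatSol μ t x)| + M * heatSol μ t x)
    (Eventually.of_forall fun n => (integrable_heatSol_mul_deformedLog μ (smallExponent_pos n)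
      (smallExponent_le_one n) ht).aestronglyMeasurable)
    (Eventually.of_forall fun n => ae_of_all _ fun x => ?_)
    (hi.abs.add ((integrable_heatSol μ ht).const_mul M))
    (ae_of_all _ fun x => (tendsto_deformedLog (heatSol_pos μ ht x)).const_mul _)).neg
  have h0 := heatSol_pos μ ht x
  have h1 := deformedLog_le (smallExponent_pos n) (smallExponent_le_one n) h0
  have h2 := mul_le_mul_of_nonneg_left (log_le_deformedLog (smallExponent_pos n) h0) h0.le
  have h3 : deformedLog (smallExponent n) (heatSol μ t x) ≤ M := by linarith [hM x]
  have h4 := mul_le_mul_of_nonneg_left h3 h0.le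
  have h5 := neg_abs_le (heatSol μ t x * Real.log (heatSol μ t x))
  have h6 := abs_nonneg (heatSol μ t x * Real.log (heatSol μ t x))
  have h7 : 0 ≤ M * heatSol μ t x := by positivity
  rw [Real.norm_eq_abs, abs_le]
  constructor <;> linarith

/-- De Bruijn's identity. -/
lemma hasDerivAt_shannonEntropy
    (hi : ∀ t, 0 < t → Integrable fun x => heatSol μ t x * Real.log (heatSol μ t x))
    {t : ℝ} (ht : 0 < t) :
    HasDerivAt (fun t => -∫ x, heatSol μ t x * Real.log (heatSol μ t x)) (fisherInfo μ 1 t) t := by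
  have hq : (1 : ℝ) ∈ Icc (1 : ℝ) 3 := ⟨le_rfl, by norm_num⟩
  -- The integrated identity survives h → 0; continuity of I_1 then allows differentiating it.
  have key : ∀ s, 0 < s → ∫ τ in t..s, fisherInfo μ 1 τ
      = -(∫ x, heatSol μ s x * Real.log (heatSol μ s x))
        - -∫ x, heatSol μ t x * Real.log (heatSol μ t x) := by
    intro s hs
    refine tendsto_nhds_unique (tendsto_integral_fisherInfo μ ht hs) ?_
    simp only [integral_fisherInfo_eq_sub μ (smallExponent_pos _) (smallExponent_le_one _) ht hs]
    exact (tendsto_deformedEntropy μ hs (hi s hs)).sub (tendsto_deformedEntropy μ ht (hi t ht))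
  have hc := continuousOn_fisherInfo μ hq
  have hca : ContinuousAt (fisherInfo μ 1) t := hc.continuousAt (Ioi_mem_nhds ht)
  have hd := (intervalIntegral.integral_hasDerivAt_right
    (f := fisherInfo μ 1) (a := t) (b := t) (by simp)
    (hc.stronglyMeasurableAtFilter isOpen_Ioi t ht) hca).add_const
      (-∫ x, heatSol μ t x * Real.log (heatSol μ t x))
  refine hd.congr_of_eventuallyEq ?_
  filter_upwards [Ioi_mem_nhds ht] with s hs
  rw [key s hs]
  ring

/-- Since u ≤ M, the positive part of u log u is at most Mu and has finite integral; only the other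
part can diverge. -/
lemma shannonEntropyEqTop_of_not_integrable {t : ℝ} (ht : 0 < t)
    (hi : ¬ Integrable fun x => heatSol μ t x * Real.log (heatSol μ t x)) :
    ShannonEntropyEqTop (heatSol μ t) := by
  obtain ⟨M, hM0, hM⟩ := exists_heatSol_le μ ht
  have hpos : ∫⁻ x, ENNReal.ofReal (heatSol μ t x * Real.log (heatSol μ t x)) < ⊤ := by
    refine lt_of_le_of_lt (lintegral_mono fun x => ENNReal.ofReal_le_ofReal ?_)
      ((integrable_heatSol μ ht).const_mul M).lintegral_lt_top
    have h0 := heatSol_pos μ ht x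
    have h1 := Real.log_le_sub_one_of_pos h0
    have h2 : Real.log (heatSol μ t x) ≤ M := by linarith [hM x]
    nlinarith
  refine ⟨?_, hpos⟩
  by_contra hne
  refine hi ⟨(continuous_heatSol_mul_log μ ht).aestronglyMeasurable, ?_⟩
  rw [hasFiniteIntegral_iff_norm]
  have hmeas : Measurable fun x => ENNReal.ofReal (heatSol μ t x * Real.log (heatSol μ t x)) :=
    (continuous_heatSol_mul_log μ ht).measurable.ennreal_ofReal
  refine lt_of_le_of_lt (lintegral_mono fun x => ?_)
    ((lintegral_add_left hmeas _).trans_lt (ENNReal.add_lt_top.2 ⟨hpos, Ne.lt_top hne⟩))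
  rw [Real.norm_eq_abs, abs_eq_max_neg]
  exact ((ENNReal.ofReal_max _ _).trans_le (max_le le_self_add le_add_self))

end Shannon

/-! ### From densities to measures, and the conclusion -/

section Main

variable {d : ℕ}

lemma concaveOn_and_deriv_deriv_nonpos {S F F' : ℝ → ℝ} {c : ℝ} (hc : 0 ≤ c)
    (hS : ∀ t, 0 < t → HasDerivAt S (c * F t) t) (hF : ∀ t, 0 < t → HasDerivAt F (F' t) t)
    (hF' : ∀ t, 0 < t → F' t ≤ 0) :
    ConcaveOn ℝ (Ioi (0 : ℝ)) S ∧ ∀ t : ℝ, 0 < t → DifferentiableAt ℝ S t ∧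
      DifferentiableAt ℝ (deriv S) t ∧ deriv (deriv S) t ≤ 0 := by
  have hd : ∀ t, 0 < t → HasDerivAt (deriv S) (c * F' t) t := by
    intro t ht
    refine ((hF t ht).const_mul c).congr_of_eventuallyEq ?_
    filter_upwards [Ioi_mem_nhds ht] with s hs
    exact (hS s hs).deriv
  have hneg : ∀ t, 0 < t → deriv (deriv S) t ≤ 0 := fun t ht => by
    rw [(hd t ht).deriv]
    exact mul_nonpos_of_nonneg_of_nonpos hc (hF' t ht)
  exact ⟨concaveOn_of_deriv2_nonpos' (convex_Ioi 0)
    (fun t ht => (hS t ht).differentiableAt.differentiableWithinAt)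
    (fun t ht => (hd t ht).differentiableAt.differentiableWithinAt) hneg,
    fun t ht => ⟨(hS t ht).differentiableAt, (hd t ht).differentiableAt, hneg t ht⟩⟩

/-- The measure with density `φ`. -/
def densityMeasure (φ : EuclideanSpace ℝ (Fin d) → ℝ) : Measure (EuclideanSpace ℝ (Fin d)) :=
  volume.withDensity fun x => ENNReal.ofReal (φ x)

lemma IsProbDensity.isProbabilityMeasure {φ : EuclideanSpace ℝ (Fin d) → ℝ}
    (hφ : IsProbDensity φ) : IsProbabilityMeasure (densityMeasure φ) := by
  constructor
  rw [densityMeasure, withDensity_apply _ MeasurableSet.univ, Measure.restrict_univ,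
    ← ofReal_integral_eq_lintegral_ofReal hφ.integrable hφ.nonneg, hφ.integral_eq_one,
    ENNReal.ofReal_one]

/-- Truncating φ at zero in `densityMeasure` changes it only on a null set. -/
lemma IsProbDensity.heatFlow_eq {φ : EuclideanSpace ℝ (Fin d) → ℝ} (hφ : IsProbDensity φ)
    (t : ℝ) : heatFlow φ t = heatSol (densityMeasure φ) t := by
  funext x
  rw [heatFlow, convolution, heatSol, kernelAverage, densityMeasure,
    integral_withDensity_eq_integral_toReal_smul₀ hφ.integrable.aemeasurable.ennreal_ofReal
      (ae_of_all _ fun _ => ENNReal.ofReal_lt_top)]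
  refine integral_congr_ae ?_
  filter_upwards [hφ.nonneg] with y hy
  simp [ENNReal.toReal_ofReal hy]

lemma hasDerivAt_tsallisEntropy (μ : Measure (EuclideanSpace ℝ (Fin d))) [IsProbabilityMeasure μ]
    {q : ℝ} (hq : q ∈ Icc (1 : ℝ) 3) (hq1 : q ≠ 1) {t : ℝ} (ht : 0 < t) :
    HasDerivAt (fun t => tsallisEntropy q (heatSol μ t)) (q * fisherInfo μ q t) t := by
  simp only [tsallisEntropy, if_neg hq1]
  refine (((hasDerivAt_integral_heatSol_rpow μ ht hq).const_sub 1).div_const (q - 1)).congr_deriv ?_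
  have : q - 1 ≠ 0 := sub_ne_zero.2 hq1
  field_simp

end Main

end

theorem theorem1 (d : ℕ) (q : ℝ)
    (hq : (d = 1 ∧ q ∈ Icc (1 : ℝ) 3) ∨
      (1 < d ∧ q ∈ Icc (1 : ℝ) (2 * (Real.sqrt 5 + 1) / Real.sqrt 5)))
    (φ₀ : EuclideanSpace ℝ (Fin d) → ℝ) (hφ₀ : IsProbDensity φ₀) :
    ((∀ t : ℝ, 0 < t → TsallisFinite q (heatFlow φ₀ t)) ∧
      ConcaveOn ℝ (Ioi (0 : ℝ)) (fun t => tsallisEntropy q (heatFlow φ₀ t)) ∧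
      ∀ t : ℝ, 0 < t →
        DifferentiableAt ℝ (fun s => tsallisEntropy q (heatFlow φ₀ s)) t ∧
        DifferentiableAt ℝ (deriv (fun s => tsallisEntropy q (heatFlow φ₀ s))) t ∧
        deriv (deriv (fun s => tsallisEntropy q (heatFlow φ₀ s))) t ≤ 0) ∨
    (q = 1 ∧ ∀ t : ℝ, 0 < t → ShannonEntropyEqTop (heatFlow φ₀ t)) := by
  have hprob := hφ₀.isProbabilityMeasure
  simp only [hφ₀.heatFlow_eq]
  set μ := densityMeasure φ₀
  have hq3 := mem_Icc_of_exponent_range hq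
  have hF : ∀ t, 0 < t → HasDerivAt (fisherInfo μ q) (∫ x, fisherRate μ q t x) t :=
    fun t ht => hasDerivAt_fisherInfo μ ht hq3
  have hF' : ∀ t, 0 < t → ∫ x, fisherRate μ q t x ≤ 0 :=
    fun t ht => integral_fisherRate_nonpos μ ht hq
  have hq0 : 0 ≤ q := zero_le_one.trans hq3.1
  by_cases hq1 : q = 1
  -- Finiteness at one time propagates to all times, so the alternative is infinite entropy at every
  -- time.
  · by_cases hfin : ∃ s, 0 < s ∧ Integrable fun x => heatSol μ s x * Real.log (heatSol μ s x)
    · obtain ⟨s, hs, hi⟩ := hfin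
      have hall : ∀ t, 0 < t → Integrable fun x => heatSol μ t x * Real.log (heatSol μ t x) :=
        fun t ht => integrable_mul_log_of_integrable μ hs ht hi
      refine Or.inl ⟨fun t ht => ?_, concaveOn_and_deriv_deriv_nonpos hq0 (fun t ht => ?_) hF hF'⟩
      · rw [TsallisFinite, if_pos hq1]
        exact hall t ht
      · simp only [tsallisEntropy, if_pos hq1]
        rw [hq1, one_mul]
        exact hasDerivAt_shannonEntropy μ hall ht
    · push Not at hfin
      exact Or.inr ⟨hq1, fun t ht => shannonEntropyEqTop_of_not_integrable μ ht (hfin t ht)⟩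
  · refine Or.inl ⟨fun t ht => ?_, concaveOn_and_deriv_deriv_nonpos hq0
      (fun t ht => hasDerivAt_tsallisEntropy μ hq3 hq1 ht) hF hF'⟩
    rw [TsallisFinite, if_neg hq1]
    exact integrable_heatSol_rpow ht hq3
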